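/- **Setting.** Let $\mathcal V=\{1,\dots,M\}$ be the vertices (agents) of an undirected graph without loops, with neighbor sets $\mathcal N_i$. Consider the nonlinear program $$\min_{x_1,\dots,x_M}\ \sum_{i\in\mathcal V} f_i(x_i,x_{\mathcal N_i})\quad\text{s.t.}\quad g_i(x_i,x_{\mathcal N_i})=0,\quad h_i(x_i,x_{\mathcal N_i})\le 0\quad(i\in\mathcal V),$$ with $x_i\in\mathbb R^{n_i}$, in neighbor-affine form: $f_i=f_{ii}(x_i)+\sum_{j\in\mathcal N_i}f_{ij}(x_i,x_j)$ with real values, and likewise $g_i=g_{ii}+\sum_{j\in\mathcal N_i} g_{ij}$ with values in $\mathbb R^{n_{gi}}$ and $h_i=h_{ii}+\sum_{j\in\mathcal N_i} h_{ij}$ with values in $\mathbb R^{n_{hi}}$, where all these functions are three times continuously differentiable. Put $L_i=f_i+\lambda_i^\top g_i+\mu_i^\top h_i$, $L=\sum_i L_i$, and $p=[x_i,\lambda_i,\mu_i]_{i\in\mathcal V}$, with Euclidean norm $\|\cdot\|$ and closed balls $\mathcal B_r(p)$. **Algorithm 2.** Given the iterate $p^{q-1}$, each agent $i$ computes a local minimizer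 $x_i^q$, with KKT multipliers $\lambda_i^q,\mu_i^q$, of $$\min_{x_i}\ f_i(x_i,x_{\mathcal N_i}^{q-1})+\sum_{j\in\mathcal N_i}\big(\nabla_{x_i}L_j^{q-1}\big)^\top(x_i-x_i^{q-1})\quad\text{s.t.}\quad g_i(x_i,x_{\mathcal N_i}^{q-1})=0,\quad h_i(x_i,x_{\mathcal N_i}^{q-1})\le 0,$$ where $\nabla_{x_i}L_j^{q-1}$ is $\nabla_{x_i}L_j$ evaluated at $p^{q-1}$. Let $$\hat F(p,p^{q-1})=\Big[\nabla_{x_i}L_i(x_i,\lambda_i,\mu_i,x_{\mathcal N_i}^{q-1})+\sum_{j\in\mathcal N_i}\nabla_{x_i}L_j^{q-1},\ \ g_i(x_i,x_{\mathcal N_i}^{q-1}),\ \ \operatorname{diag}(\mu_i)\,h_i(x_i,x_{\mathcal N_i}^{q-1})\Big]_{i\in\mathcal V}$$ collect the equalities of the KKT conditions of these local programs. **Assumptions.** Let $p^*$ be a KKT point of the central program. 1. At $p^*$ the central program satisfies strict complementarity; the second-order sufficient condition $s^\top\nabla^2_{xx}L\,s>0$ for all $s\ne0$ that are annihilated by the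 Jacobians of all equality and all active inequality constraints; and linear independence of the gradients of all equality and all active inequality constraints. 2. For every $i$, the same second-order condition (with $\nabla^2_{x_ix_i}L_i$, $\nabla_{x_i}g_i$, $\nabla_{x_i}h_i$) and the same linear independence condition (with the gradients in $x_i$) hold at $p^*$ for the local program of agent $i$. 3. At $x^*$, for all $i\in\mathcal V$ and $j\in\mathcal N_i$: $\nabla^2_{x_ix_j}f_{ij}=\nabla^2_{x_jx_j}f_{ij}=0$, $\ \nabla_{x_j}g_{ij}=\nabla^2_{x_ix_j}g_{ij}=\nabla^2_{x_jx_j}g_{ij}=0$, and $\nabla_{x_j}h_{ij}=\nabla^2_{x_ix_j}h_{ij}=\nabla^2_{x_jx_j}h_{ij}=0$. **Conclusion.** There are $\rho,r_1>0$ and a map $\Phi$, continuously differentiable on $\mathcal B_{r_1}(p^*)$ and with $\Phi(p^*)=p^*$, such that for every $p\in\mathcal B_{r_1}(p^*)$ the point $\Phi(p)\in\mathcal B_\rho(p^*)$ is a result of one iteration of Algorithm 2 from $p$, and is the only KKT point in $\mathcal B_\rho(p^*)$ of the local programs built from $p$. The matrix $N(p):=\nabla_{p'}\hat F(\Phi(p),p')\big|_{p'=p}$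 and the Jacobian $J(p):=\nabla\Phi(p)$ satisfy $$N(p^*)=0\quad\text{and}\quad J(p^*)=0.$$ Moreover, Algorithm 2 converges quadratically near $p^*$: there are $r\in(0,r_1]$ and $\tilde C<\infty$ such that for every $p^0\in\mathcal B_r(p^*)$, Algorithm 2, with local solutions taken in $\mathcal B_\rho(p^*)$, generates exactly one sequence $(p^q)$; this sequence satisfies $p^q=\Phi(p^{q-1})$ for all $q\ge1$, stays in $\mathcal B_r(p^*)$, converges to $p^*$, and $$\|p^q-p^*\|\le\tilde C\,\|p^{q-1}-p^*\|^2\qquad(q=1,2,\dots).$$ -/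

import Mathlib

open Filter Topology

namespace SBDP

/-- The Euclidean space `ℝ^m`. -/
abbrev E (m : ℕ) : Type := EuclideanSpace ℝ (Fin m)

/-! ### Partial derivatives of a function of two vector arguments -/

section PartialDerivatives

variable {X Y Z : Type*} [NormedAddCommGroup X] [NormedSpace ℝ X]
  [NormedAddCommGroup Y] [NormedSpace ℝ Y] [NormedAddCommGroup Z] [NormedSpace ℝ Z]

/-- Second derivative of `φ` at `x`, as a bilinear form. -/
noncomputable def hess (φ : X → Z) (x : X) : X →L[ℝ] X →L[ℝ] Z :=
  fderiv ℝ (fun x' => fderiv ℝ φ x') x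

/-- `∇_y φ (x, y)`. -/
noncomputable def dY (φ : X → Y → Z) (x : X) (y : Y) : Y →L[ℝ] Z :=
  fderiv ℝ (φ x) y

/-- `∇²_{x y} φ (x, y)`. -/
noncomputable def dXY (φ : X → Y → Z) (x : X) (y : Y) : X →L[ℝ] Y →L[ℝ] Z :=
  fderiv ℝ (fun x' => dY φ x' y) x

/-- `∇²_{y y} φ (x, y)`. -/
noncomputable def dYY (φ : X → Y → Z) (x : X) (y : Y) : Y →L[ℝ] Y →L[ℝ] Z :=
  hess (φ x) y

end PartialDerivatives

/-! ### The nonlinear program -/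

/-- A nonlinear program in neighbor-affine form over an undirected graph with agents `Fin M`.
Agent `i` has `n i` decision variables, `ng i` equality and `nh i` inequality constraints;
only the coupling functions with `j` adjacent to `i` enter the program. All functions that enter
are three times continuously differentiable. -/
structure NeighborAffineNLP (M : ℕ) where
  graph : SimpleGraph (Fin M)
  n : Fin M → ℕ
  ng : Fin M → ℕ
  nh : Fin M → ℕ
  fLoc : ∀ i, E (n i) → ℝ
  fCpl : ∀ i j, E (n i) → E (n j) → ℝ
  gLoc : ∀ i, E (n i) → E (ng i)
  gCpl : ∀ i j, E (n i) → E (n j) → E (ng i)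
  hLoc : ∀ i, E (n i) → E (nh i)
  hCpl : ∀ i j, E (n i) → E (n j) → E (nh i)
  fLoc_smooth : ∀ i, ContDiff ℝ 3 (fLoc i)
  gLoc_smooth : ∀ i, ContDiff ℝ 3 (gLoc i)
  hLoc_smooth : ∀ i, ContDiff ℝ 3 (hLoc i)
  fCpl_smooth : ∀ i j, graph.Adj i j → ContDiff ℝ 3 (Function.uncurry (fCpl i j))
  gCpl_smooth : ∀ i j, graph.Adj i j → ContDiff ℝ 3 (Function.uncurry (gCpl i j))
  hCpl_smooth : ∀ i j, graph.Adj i j → ContDiff ℝ 3 (Function.uncurry (hCpl i j))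

namespace NeighborAffineNLP

variable {M : ℕ} (P : NeighborAffineNLP M)

open Classical in
/-- The neighbors `𝒩_i`. -/
noncomputable def nbrs (i : Fin M) : Finset (Fin M) :=
  Finset.univ.filter (fun j => P.graph.Adj i j)

/-- Stacked decision variables `x = [x_i]`. -/
abbrev XVar : Type := ∀ i : Fin M, E (P.n i)

/-- Stacked primal-dual variables `p = [x_i, λ_i, μ_i]`. -/
abbrev Var : Type := ∀ i : Fin M, E (P.n i) × E (P.ng i) × E (P.nh i)

/-- The decision variables of `p`. -/
def xOf (p : P.Var) : P.XVar := fun i => (p i).1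

/-- The Euclidean norm of `p`. -/
noncomputable def eNorm (p : P.Var) : ℝ :=
  Real.sqrt (∑ i, (‖(p i).1‖ ^ 2 + ‖(p i).2.1‖ ^ 2 + ‖(p i).2.2‖ ^ 2))

/-- The closed Euclidean `r`-neighborhood of `p₀`. -/
def nhd (p₀ : P.Var) (r : ℝ) : Set P.Var := {p | P.eNorm (p - p₀) ≤ r}

/-- `f_i(x_i, x_{𝒩_i})`; of the second argument only the entries in `𝒩_i` are used
(and `i ∉ 𝒩_i`). The same convention holds for `g`, `h` and `lag`. -/
noncomputable def f (i : Fin M) (xi : E (P.n i)) (x : P.XVar) : ℝ :=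
  P.fLoc i xi + ∑ j ∈ P.nbrs i, P.fCpl i j xi (x j)

/-- `g_i(x_i, x_{𝒩_i})`. -/
noncomputable def g (i : Fin M) (xi : E (P.n i)) (x : P.XVar) : E (P.ng i) :=
  P.gLoc i xi + ∑ j ∈ P.nbrs i, P.gCpl i j xi (x j)

/-- `h_i(x_i, x_{𝒩_i})`. -/
noncomputable def h (i : Fin M) (xi : E (P.n i)) (x : P.XVar) : E (P.nh i) :=
  P.hLoc i xi + ∑ j ∈ P.nbrs i, P.hCpl i j xi (x j)

/-- The local Lagrangian `L_i(x_i, λ_i, μ_i, x_{𝒩_i})`. -/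
noncomputable def lag (i : Fin M) (xi : E (P.n i)) (lam : E (P.ng i)) (mu : E (P.nh i))
    (x : P.XVar) : ℝ :=
  P.f i xi x + inner ℝ lam (P.g i xi x) + inner ℝ mu (P.h i xi x)

/-- The central Lagrangian as a function of `x`, with the multipliers taken from `p`. -/
noncomputable def centralLag (p : P.Var) (x : P.XVar) : ℝ :=
  ∑ i, P.lag i (x i) (p i).2.1 (p i).2.2 x

/-! ### Central optimality conditions and regularity -/

/-- `p` is a KKT point of the central program
`min ∑ f_i` subject to `g_i = 0`, `h_i ≤ 0` for all agents `i`. -/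
structure IsCentralKKT (p : P.Var) : Prop where
  stationary : ∀ i,
    gradient (fun y => P.centralLag p (Function.update (P.xOf p) i y)) (p i).1 = 0
  eq_zero : ∀ i, P.g i (p i).1 (P.xOf p) = 0
  compl : ∀ i k, (p i).2.2 k * P.h i (p i).1 (P.xOf p) k = 0
  nonpos : ∀ i k, P.h i (p i).1 (P.xOf p) k ≤ 0
  nonneg : ∀ i k, 0 ≤ (p i).2.2 k

/-- The `k`-th inequality constraint of agent `i` is active at `p`. -/
def Active (p : P.Var) (i : Fin M) (k : Fin (P.nh i)) : Prop :=
  P.h i (p i).1 (P.xOf p) k = 0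

/-- Strict complementarity, second-order sufficient condition and linear independence of the
gradients of all equality and all active inequality constraints for the central program. -/
structure CentralRegular (p : P.Var) : Prop where
  kkt : P.IsCentralKKT p
  strict : ∀ i k, P.Active p i k → 0 < (p i).2.2 k
  sosc : ∀ s : P.XVar, s ≠ 0 →
    (∀ i, fderiv ℝ (fun x : P.XVar => P.g i (x i) x) (P.xOf p) s = 0) →
    (∀ i k, P.Active p i k →
      fderiv ℝ (fun x : P.XVar => P.h i (x i) x k) (P.xOf p) s = 0) →
    0 < hess (P.centralLag p) (P.xOf p) s s
  licq : LinearIndependent ℝ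
    (Sum.elim
      (fun a : (Σ i, Fin (P.ng i)) =>
        fderiv ℝ (fun x : P.XVar => P.g a.1 (x a.1) x a.2) (P.xOf p))
      (fun a : {a : (Σ i, Fin (P.nh i)) // P.Active p a.1 a.2} =>
        fderiv ℝ (fun x : P.XVar => P.h a.1.1 (x a.1.1) x a.1.2) (P.xOf p)))

/-- Second-order sufficient condition and linear independence of the constraint gradients for the
local program of every agent, in which only `x_i` varies. -/
structure LocalRegular (p : P.Var) : Prop where
  sosc : ∀ i, ∀ s : E (P.n i), s ≠ 0 →
    fderiv ℝ (fun y => P.g i y (P.xOf p)) (p i).1 s = 0 →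
    (∀ k, P.Active p i k → fderiv ℝ (fun y => P.h i y (P.xOf p) k) (p i).1 s = 0) →
    0 < hess (fun y => P.lag i y (p i).2.1 (p i).2.2 (P.xOf p)) (p i).1 s s
  licq : ∀ i, LinearIndependent ℝ
    (Sum.elim
      (fun k : Fin (P.ng i) => fderiv ℝ (fun y => P.g i y (P.xOf p) k) (p i).1)
      (fun k : {k : Fin (P.nh i) // P.Active p i k} =>
        fderiv ℝ (fun y => P.h i y (P.xOf p) k.1) (p i).1))

/-! ### The algorithm -/

/-- The sensitivity `∇_{x_i} L_j` evaluated at `p`, for `j ≠ i`. -/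
noncomputable def sens (p : P.Var) (i j : Fin M) : E (P.n i) :=
  gradient (fun y => P.lag j (p j).1 (p j).2.1 (p j).2.2 (Function.update (P.xOf p) i y)) (p i).1

/-- Objective of the modified local program of agent `i`, built from the previous iterate. -/
noncomputable def localObj (prev : P.Var) (i : Fin M) (xi : E (P.n i)) : ℝ :=
  P.f i xi (P.xOf prev) + ∑ j ∈ P.nbrs i, inner ℝ (P.sens prev i j) (xi - (prev i).1)

/-- Feasible set of the modified local program of agent `i`. -/
def localFeasible (prev : P.Var) (i : Fin M) : Set (E (P.n i)) :=
  {xi | P.g i xi (P.xOf prev) = 0 ∧ ∀ k, P.h i xi (P.xOf prev) k ≤ 0}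

/-- The map `F̂(p, prev)` that collects the equalities of the KKT conditions of all modified local
programs: stationarity, equality constraints, complementarity. -/
noncomputable def Fhat (p prev : P.Var) : P.Var := fun i =>
  (gradient (fun y => P.lag i y (p i).2.1 (p i).2.2 (P.xOf prev)) (p i).1
      + ∑ j ∈ P.nbrs i, P.sens prev i j,
    P.g i (p i).1 (P.xOf prev),
    WithLp.toLp 2 (fun k => (p i).2.2 k * P.h i (p i).1 (P.xOf prev) k))

/-- `p` is a KKT point of the modified local programs of all agents. -/
structure IsLocalKKT (prev p : P.Var) : Prop where
  eqs : P.Fhat p prev = 0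
  nonpos : ∀ i k, P.h i (p i).1 (P.xOf prev) k ≤ 0
  nonneg : ∀ i k, 0 ≤ (p i).2.2 k

/-- One iteration of the algorithm: every agent `i` solves its modified local program, i.e. `x_i`
is a local minimizer and `λ_i`, `μ_i` are corresponding multipliers. -/
structure IsStep (prev p : P.Var) : Prop where
  kkt : P.IsLocalKKT prev p
  isMin : ∀ i, IsLocalMinOn (P.localObj prev i) (P.localFeasible prev i) (p i).1

/-- `p 0, p 1, …` is generated by the algorithm started at `p0`, where every local solve returns a
solution in `U`. -/
structure IsRun (U : Set P.Var) (p0 : P.Var) (p : ℕ → P.Var) : Prop where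
  init : p 0 = p0
  step : ∀ q, P.IsStep (p q) (p (q + 1))
  mem : ∀ q, p (q + 1) ∈ U

/-- The condition on the coupling functions at `x`. -/
structure CouplingVanishes (x : P.XVar) : Prop where
  f_xy : ∀ i j, P.graph.Adj i j → dXY (P.fCpl i j) (x i) (x j) = 0
  f_yy : ∀ i j, P.graph.Adj i j → dYY (P.fCpl i j) (x i) (x j) = 0
  g_y : ∀ i j, P.graph.Adj i j → dY (P.gCpl i j) (x i) (x j) = 0
  g_xy : ∀ i j, P.graph.Adj i j → dXY (P.gCpl i j) (x i) (x j) = 0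
  g_yy : ∀ i j, P.graph.Adj i j → dYY (P.gCpl i j) (x i) (x j) = 0
  h_y : ∀ i j, P.graph.Adj i j → dY (P.hCpl i j) (x i) (x j) = 0
  h_xy : ∀ i j, P.graph.Adj i j → dXY (P.hCpl i j) (x i) (x j) = 0
  h_yy : ∀ i j, P.graph.Adj i j → dYY (P.hCpl i j) (x i) (x j) = 0

end NeighborAffineNLP

end SBDP

/-! Near $p^*$ one iteration is the solution map of the equation $\hat F(p,p')=0$, solved for $p$
with the previous iterate $p'$ as parameter. The point $p^*$ solves it with $p'=p^*$, because the
derivative of the central Lagrangian in $x_i$ is that of $L_i$ plus the sensitivities of the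
neighbors (`Fhat_self`). For fixed $p'$ the Jacobian in $p$ is block diagonal over the agents. Each
block is the KKT matrix of a local program, injective by strict complementarity, the second-order
condition and linear independence (`kktMap_fderiv_injective`). The implicit function theorem then
gives $\Phi$, with $\nabla\Phi(p^*)=-(\nabla_p\hat F)^{-1}N(p^*)$ (`exists_implicit_map`).

The coupling assumptions say that everything through which $\hat F$ sees the previous iterate is
stationary at $p^*$, so $N(p^*)=0$ (`hasFDerivAt_Fhat_prev`) and hence $J(p^*)=0$. Three derivatives
of the data make $\hat F$ and $\Phi$ twice continuously differentiable. A vanishing derivative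
therefore yields a quadratic error bound (`exists_quadratic_bound`), and the iteration contracts on
a small ball.

It remains to see that a zero of $\hat F$ near $(p^*,p^*)$ is a genuine local solution
(`eventually_isStep`). Strict complementarity freezes the active set and so gives the sign
conditions. Minimality comes from an augmented Lagrangian with positive definite Hessian, a property
that survives small perturbations of both iterates. -/

namespace SBDP

/-! ### Coercivity and the second derivative test. -/

section Analysis

/-- If `Q > 0` on the zero set of a nonnegative `R`, then `Q + c R > 0` on the compact set `K`
for some `c`. -/
theorem exists_forall_pos_add_mul {X : Type*} [TopologicalSpace X] {K : Set X}
    (hK : IsCompact K) {Q R : X → ℝ}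
    (hQ : Continuous Q) (hR : Continuous R) (hR0 : ∀ s, 0 ≤ R s)
    (hpos : ∀ s ∈ K, R s = 0 → 0 < Q s) : ∃ c : ℝ, ∀ s ∈ K, 0 < Q s + c * R s := by
  -- These open sets increase with $m$ because $R\ge0$, and they cover $K$; by compactness a single
  -- $m$ suffices.
  have hdir : Directed (· ⊆ ·) (fun m : ℕ => {s | 0 < Q s + m * R s}) := by
    refine directed_of_isDirected_le fun a b hab s hs => ?_
    have : (a : ℝ) * R s ≤ b * R s := by gcongr; exact hR0 s
    simp only [Set.mem_ofPred_eq] at hs ⊢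
    linarith
  obtain ⟨m, hm⟩ := hK.elim_directed_cover (fun m : ℕ => {s | 0 < Q s + m * R s})
    (fun m => isOpen_lt continuous_const (by fun_prop)) (fun s hs => by
      simp only [Set.mem_iUnion, Set.mem_ofPred_eq]
      rcases (hR0 s).eq_or_lt with h | h
      · exact ⟨0, by simpa using hpos s hs h.symm⟩
      · obtain ⟨m, hm⟩ := exists_nat_gt (-Q s / R s)
        rw [div_lt_iff₀ h] at hm
        exact ⟨m, by linarith⟩) hdir
  exact ⟨m, fun s hs => hm hs⟩

variable {X : Type*} [NormedAddCommGroup X] [NormedSpace ℝ X] [FiniteDimensional ℝ X]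

/-- A positive definite form is coercive. -/
theorem exists_coercive (B : X →L[ℝ] X →L[ℝ] ℝ) (hB : ∀ s, s ≠ 0 → 0 < B s s) :
    ∃ m : ℝ, 0 < m ∧ ∀ s, m * ‖s‖ ^ 2 ≤ B s s := by
  obtain ⟨m, hm, hle⟩ : ∃ m : ℝ, 0 < m ∧ ∀ s ∈ Metric.sphere (0 : X) 1, m ≤ B s s := by
    rcases (Metric.sphere (0 : X) 1).eq_empty_or_nonempty with h | h
    · exact ⟨1, one_pos, by simp [h]⟩
    · obtain ⟨s, hs, hmin⟩ := (isCompact_sphere (0 : X) 1).exists_isMinOn h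
        (f := fun s => B s s) (by fun_prop)
      exact ⟨B s s, hB s (ne_zero_of_mem_unit_sphere ⟨s, hs⟩), fun t ht => hmin ht⟩
  refine ⟨m, hm, fun s => ?_⟩
  rcases eq_or_ne s 0 with rfl | hs
  · simp
  have hn : 0 < ‖s‖ := norm_pos_iff.mpr hs
  have := hle (‖s‖⁻¹ • s) (by simp [norm_smul, hn.ne'])
  simp only [map_smul, smul_apply, smul_eq_mul] at this
  have h2 : m * ‖s‖ ^ 2 ≤ (‖s‖⁻¹ * (‖s‖⁻¹ * B s s)) * ‖s‖ ^ 2 := by gcongr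
  convert h2 using 1
  field_simp

theorem eventually_norm_sub_lt_of_continuousAt {V T : Type*} [NormedAddCommGroup V]
    [TopologicalSpace T] {B : T → V} {t₀ : T} (hB : ContinuousAt B t₀) {m : ℝ} (hm : 0 < m) :
    ∀ᶠ t in 𝓝 t₀, ‖B t - B t₀‖ < m := by
  simpa only [dist_eq_norm] using Metric.tendsto_nhds.mp hB.tendsto m hm

/-- Positive definiteness is an open condition. -/
theorem eventually_pos_def {T : Type*} [TopologicalSpace T] {B : T → X →L[ℝ] X →L[ℝ] ℝ} {t₀ : T}
    (hB : ContinuousAt B t₀) (hpos : ∀ s, s ≠ 0 → 0 < B t₀ s s) :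
    ∀ᶠ t in 𝓝 t₀, ∀ s, s ≠ 0 → 0 < B t s s := by
  obtain ⟨m, hm, hle⟩ := exists_coercive (B t₀) hpos
  have hev : ∀ᶠ t in 𝓝 t₀, ‖B t - B t₀‖ < m :=
    eventually_norm_sub_lt_of_continuousAt (V := X →L[ℝ] X →L[ℝ] ℝ) hB hm
  filter_upwards [hev] with t ht s hs
  have h1 := (B t - B t₀).le_opNorm₂ s s
  rw [Real.norm_eq_abs] at h1
  have h2 := neg_le_of_abs_le h1
  simp only [sub_apply] at h2
  have hn : 0 < ‖s‖ := norm_pos_iff.mpr hs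
  have h3 : ‖B t - B t₀‖ * ‖s‖ * ‖s‖ < m * ‖s‖ * ‖s‖ := by gcongr
  nlinarith [hle s]

/-- The second derivative test. -/
theorem isLocalMin_of_hess_pos {f : X → ℝ} {x : X} (hf : ContDiff ℝ 2 f)
    (h1 : fderiv ℝ f x = 0) (h2 : ∀ s, s ≠ 0 → 0 < hess f x s s) : IsLocalMin f x := by
  obtain ⟨m, hm, hle⟩ := exists_coercive _ h2
  have hd : HasFDerivAt (fderiv ℝ f) (hess f x) x :=
    ((hf.fderiv_right (m := 1) (by norm_num)).differentiable (by norm_num) x).hasFDerivAt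
  obtain ⟨ε, hε, hball⟩ := Metric.eventually_nhds_iff_ball.mp (hd.isLittleO.def hm)
  -- The linearization error of the gradient is bounded with the coercivity constant $m$ itself, so
  -- it cannot outweigh the quadratic term.
  have key : ∀ z ∈ Metric.ball x ε, 0 ≤ fderiv ℝ f z (z - x) := by
    intro z hz
    have h3 := hball z hz
    rw [h1, sub_zero] at h3
    have h4 := (fderiv ℝ f z - hess f x (z - x)).le_opNorm (z - x)
    rw [Real.norm_eq_abs] at h4
    have h5 := neg_le_of_abs_le h4
    simp only [sub_apply] at h5
    have h6 : ‖fderiv ℝ f z - hess f x (z - x)‖ * ‖z - x‖ ≤ m * ‖z - x‖ * ‖z - x‖ := by gcongr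
    have h7 := hle (z - x)
    nlinarith
  filter_upwards [Metric.ball_mem_nhds x hε] with y hy
  obtain ⟨z, hz, hzy⟩ := domain_mvt (f := f) (f' := fun z => fderiv ℝ f z)
    (s := Metric.ball x ε) (x := x) (y := y)
    (fun z _ => (hf.differentiable (by norm_num) z).hasFDerivAt.hasFDerivWithinAt)
    (convex_ball x ε) (Metric.mem_ball_self hε) hy
  have hzb := (convex_ball x ε).segment_subset (Metric.mem_ball_self hε) hy hz
  rw [segment_eq_image'] at hz
  obtain ⟨t, ⟨ht0, -⟩, rfl⟩ := hz
  -- Here $z=x+t(y-x)$, so `key` carries a factor $t$; it is divided out, and for $t=0$ the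
  -- derivative vanishes anyway.
  have h8 := key _ hzb
  simp only [add_sub_cancel_left, map_smul, smul_eq_mul] at h8
  rcases ht0.eq_or_lt with rfl | ht
  · simp only [zero_smul, add_zero, h1, zero_apply] at hzy
    linarith
  · have := nonneg_of_mul_nonneg_right h8 ht
    linarith

end Analysis

/-! ### Implicit maps with vanishing derivative. -/

section FixedPoint

variable {W : Type*} [NormedAddCommGroup W] [NormedSpace ℝ W]

/-- A `C²` map whose derivative vanishes at `p₀` is quadratically close to its value there. -/
theorem exists_quadratic_bound {Φ : W → W} {p₀ : W} (hΦ : ContDiffAt ℝ 2 Φ p₀)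
    (h0 : HasFDerivAt Φ (0 : W →L[ℝ] W) p₀) :
    ∃ C : ℝ, 0 < C ∧ ∀ᶠ p in 𝓝 p₀, ‖Φ p - Φ p₀‖ ≤ C * ‖p - p₀‖ ^ 2 := by
  have h1 : ContDiffAt ℝ 1 (fderiv ℝ Φ) p₀ := hΦ.fderiv_right (by norm_num)
  obtain ⟨C, hC, hO⟩ := (h1.differentiableAt (by norm_num)).isBigO_sub.exists_pos
  have hdiff : ∀ᶠ p in 𝓝 p₀, DifferentiableAt ℝ Φ p :=
    (hΦ.eventually (by simp)).mono fun p hp => hp.differentiableAt (by norm_num)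
  obtain ⟨ε, hε, hball⟩ := Metric.eventually_nhds_iff_ball.mp (hO.bound.and hdiff)
  refine ⟨C, hC, ?_⟩
  filter_upwards [Metric.ball_mem_nhds p₀ hε] with p hp
  -- On the ball through $p$ the derivative is at most $C\|p-p_0\|$; the mean value inequality adds
  -- the second factor $\|p-p_0\|$.
  have hsub : Metric.closedBall p₀ ‖p - p₀‖ ⊆ Metric.ball p₀ ε := by
    intro z hz
    rw [Metric.mem_ball, dist_eq_norm] at *
    rw [Metric.mem_closedBall, dist_eq_norm] at hz
    exact hz.trans_lt hp
  have := (convex_closedBall p₀ ‖p - p₀‖).norm_image_sub_le_of_norm_fderiv_le (𝕜 := ℝ) (f := Φ)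
    (C := C * ‖p - p₀‖) (x := p₀) (y := p) (fun z hz => (hball z (hsub hz)).2)
    (fun z hz => by
      have h := (hball z (hsub hz)).1
      rw [h0.fderiv, sub_zero] at h
      rw [Metric.mem_closedBall, dist_eq_norm] at hz
      exact h.trans (by gcongr))
    (by simp) (by simp [dist_eq_norm])
  linarith

/-- Implicit function for `F (Φ q) q = 0` when the derivative of `F` in its second argument
vanishes at the base point. -/
theorem exists_implicit_map [FiniteDimensional ℝ W] {F : W → W → W} {p₀ : W}
    (hF : ContDiff ℝ 2 (fun v : W × W => F v.2 v.1)) (hF0 : F p₀ p₀ = 0)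
    (h1 : ∀ v, fderiv ℝ (fun p => F p p₀) p₀ v = 0 → v = 0)
    (h2 : HasFDerivAt (fun q => F p₀ q) (0 : W →L[ℝ] W) p₀) :
    ∃ Φ : W → W, ContDiffAt ℝ 2 Φ p₀ ∧ Φ p₀ = p₀ ∧ HasFDerivAt Φ (0 : W →L[ℝ] W) p₀ ∧
      ∀ᶠ v in 𝓝 (p₀, p₀), F v.2 v.1 = 0 ↔ Φ v.1 = v.2 := by
  -- The arguments are swapped so that the parameter (the previous iterate) comes first and the
  -- unknown second.
  set G : W × W → W := fun v => F v.2 v.1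
  have hd : HasFDerivAt G (fderiv ℝ G (p₀, p₀)) (p₀, p₀) :=
    (hF.differentiable (by norm_num) _).hasFDerivAt
  have hr : HasFDerivAt (fun p => F p p₀) (fderiv ℝ G (p₀, p₀) ∘L .inr ℝ W W) p₀ :=
    HasFDerivAt.comp (g := G) p₀ hd (hasFDerivAt_prodMk_right p₀ p₀)
  have hl : HasFDerivAt (fun q => F p₀ q) (fderiv ℝ G (p₀, p₀) ∘L .inl ℝ W W) p₀ :=
    HasFDerivAt.comp (g := G) (f := fun q => (q, p₀)) p₀ hd (hasFDerivAt_prodMk_left p₀ p₀)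
  have hinj : Function.Injective (fderiv ℝ G (p₀, p₀) ∘L .inr ℝ W W) := by
    rw [injective_iff_map_eq_zero]
    intro v hv
    exact h1 v (by rw [hr.fderiv]; exact hv)
  have hinv : (fderiv ℝ G (p₀, p₀) ∘L .inr ℝ W W).IsInvertible :=
    ⟨(LinearEquiv.ofInjectiveEndo _ hinj).toContinuousLinearEquiv, by ext; rfl⟩
  have hc : ContDiffAt ℝ 2 G (p₀, p₀) := hF.contDiffAt
  refine ⟨hc.implicitFunction (by norm_num) hinv, hc.contDiffAt_implicitFunction _ _,
    hc.implicitFunction_apply_self _ _, ?_, ?_⟩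
  · have := (hc.hasStrictFDerivAt_implicitFunction (by norm_num) hinv).hasFDerivAt
    rwa [hl.unique h2, ContinuousLinearMap.comp_zero, neg_zero] at this
  · have := hc.eventually_apply_eq_iff_implicitFunction (by norm_num) hinv
    simpa only [G, hF0] using this

end FixedPoint

/-! ### Sufficient conditions for one program via an augmented Lagrangian. -/

section SingleProgram

variable {X : Type*} [NormedAddCommGroup X] [InnerProductSpace ℝ X] {a b : ℕ}

theorem hasFDerivAt_fderiv {Y Z : Type*} [NormedAddCommGroup Y] [NormedSpace ℝ Y]
    [NormedAddCommGroup Z] [NormedSpace ℝ Z] {φ : Y → Z} (hφ : ContDiff ℝ 2 φ) (x : Y) :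
    HasFDerivAt (fderiv ℝ φ) (hess φ x) x :=
  ((hφ.fderiv_right (m := 1) (by norm_num)).differentiable (by norm_num) x).hasFDerivAt

theorem contDiff_apply {Y : Type*} [NormedAddCommGroup Y] [NormedSpace ℝ Y] {n : WithTop ℕ∞}
    {φ : Y → E a} (hφ : ContDiff ℝ n φ) (k : Fin a) : ContDiff ℝ n (fun y => φ y k) :=
  contDiff_euclidean.mp hφ k

theorem fderiv_apply_coord {Y : Type*} [NormedAddCommGroup Y] [NormedSpace ℝ Y] {φ : Y → E a}
    {x : Y} (hφ : DifferentiableAt ℝ φ x) (k : Fin a) (v : Y) :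
    fderiv ℝ (fun y => φ y k) x v = fderiv ℝ φ x v k := by
  have : HasFDerivAt (fun y => φ y k) ((EuclideanSpace.proj k : E a →L[ℝ] ℝ) ∘L fderiv ℝ φ x) x :=
    (EuclideanSpace.proj k : E a →L[ℝ] ℝ).hasFDerivAt.comp x hφ.hasFDerivAt
  rw [this.fderiv]
  rfl

/-- First and second derivative of a sum of squares at a common zero. -/
theorem sum_sq_derivatives {ι : Type*} {t : Finset ι} {φ : ι → X → ℝ} {x : X}
    (hφ : ∀ k, ContDiff ℝ 2 (φ k)) (h0 : ∀ k ∈ t, φ k x = 0) :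
    fderiv ℝ (fun y => ∑ k ∈ t, φ k y ^ 2) x = 0 ∧
      ∀ v, hess (fun y => ∑ k ∈ t, φ k y ^ 2) x v v = ∑ k ∈ t, 2 * (fderiv ℝ (φ k) x v) ^ 2 := by
  have hd : ∀ k y, HasFDerivAt (φ k) (fderiv ℝ (φ k) y) y := fun k y =>
    ((hφ k).differentiable (by norm_num) y).hasFDerivAt
  have h1 : fderiv ℝ (fun y => ∑ k ∈ t, φ k y ^ 2) =
      fun y => ∑ k ∈ t, (2 * φ k y) • fderiv ℝ (φ k) y := by
    ext1 y
    refine HasFDerivAt.fderiv (HasFDerivAt.fun_sum fun k _ => ?_)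
    simpa using (hd k y).pow 2
  constructor
  · rw [h1]
    exact Finset.sum_eq_zero fun k hk => by rw [h0 k hk, mul_zero, zero_smul]
  · intro v
    have h2 : HasFDerivAt (fun y => ∑ k ∈ t, (2 * φ k y) • fderiv ℝ (φ k) y) _ x :=
      HasFDerivAt.fun_sum fun k _ => ((hd k x).const_mul 2).smul (hasFDerivAt_fderiv (hφ k) x)
    rw [hess, show (fun x' => fderiv ℝ (fun y => ∑ k ∈ t, φ k y ^ 2) x') = _ from h1, h2.fderiv]
    simp only [sum_apply, add_apply, smul_apply,
      ContinuousLinearMap.smulRight_apply]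
    refine Finset.sum_congr rfl fun k hk => ?_
    rw [h0 k hk]
    simp
    ring

theorem hess_add {φ ψ : X → ℝ} (hφ : ContDiff ℝ 2 φ) (hψ : ContDiff ℝ 2 ψ) (x : X) :
    hess (fun y => φ y + ψ y) x = hess φ x + hess ψ x := by
  have h1 : (fun y => fderiv ℝ (fun y => φ y + ψ y) y) = fun y => fderiv ℝ φ y + fderiv ℝ ψ y := by
    ext1 y
    exact fderiv_fun_add (hφ.differentiable (by norm_num) y) (hψ.differentiable (by norm_num) y)
  rw [hess, h1]
  exact ((hasFDerivAt_fderiv hφ x).add (hasFDerivAt_fderiv hψ x)).fderiv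

theorem hess_const_mul {φ : X → ℝ} (hφ : ContDiff ℝ 2 φ) (c : ℝ) (x : X) :
    hess (fun y => c * φ y) x = c • hess φ x := by
  have h1 : (fun y => fderiv ℝ (fun y => c * φ y) y) = fun y => c • fderiv ℝ φ y := by
    ext1 y
    exact fderiv_const_mul (hφ.differentiable (by norm_num) y) c
  rw [hess, h1]
  exact ((hasFDerivAt_fderiv hφ x).const_smul c).fderiv

theorem hess_affine (ℓ : X →L[ℝ] ℝ) (z x : X) : hess (fun y => ℓ (y - z)) x = 0 := by
  have h1 : (fun y => fderiv ℝ (fun y => ℓ (y - z)) y) = fun _ => ℓ := by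
    ext1 y
    exact (ℓ.hasFDerivAt.comp y ((hasFDerivAt_id y).sub_const z)).fderiv
  rw [hess, h1]
  exact fderiv_const_apply ℓ

/-- The Lagrangian of a single program. -/
noncomputable def lagr (f : X → ℝ) (g : X → E a) (h : X → E b) (lam : E a) (mu : E b) (y : X) : ℝ :=
  f y + inner ℝ lam (g y) + inner ℝ mu (h y)

/-- Quadratic penalty of the equality constraints and of the inequality constraints in `s`. -/
noncomputable def penalty (g : X → E a) (h : X → E b) (s : Finset (Fin b)) (y : X) : ℝ :=
  (∑ k, g y k ^ 2) + ∑ k ∈ s, h y k ^ 2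

variable {f : X → ℝ} {g : X → E a} {h : X → E b} {lam : E a} {mu : E b} {x : X}
  {s : Finset (Fin b)}

theorem contDiff_lagr {n : WithTop ℕ∞} (hf : ContDiff ℝ n f) (hg : ContDiff ℝ n g)
    (hh : ContDiff ℝ n h) (lam : E a) (mu : E b) : ContDiff ℝ n (lagr f g h lam mu) :=
  (hf.add (contDiff_const.inner ℝ hg)).add (contDiff_const.inner ℝ hh)

theorem contDiff_penalty {n : WithTop ℕ∞} (hg : ContDiff ℝ n g) (hh : ContDiff ℝ n h)
    (s : Finset (Fin b)) : ContDiff ℝ n (penalty g h s) :=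
  (ContDiff.sum fun k _ => (contDiff_apply hg k).pow 2).add
    (ContDiff.sum fun k _ => (contDiff_apply hh k).pow 2)

theorem penalty_derivatives (hg : ContDiff ℝ 2 g) (hh : ContDiff ℝ 2 h) (hg0 : g x = 0)
    (hh0 : ∀ k ∈ s, h x k = 0) :
    fderiv ℝ (penalty g h s) x = 0 ∧ ∀ v, hess (penalty g h s) x v v =
      (∑ k, 2 * (fderiv ℝ (fun y => g y k) x v) ^ 2) +
        ∑ k ∈ s, 2 * (fderiv ℝ (fun y => h y k) x v) ^ 2 := by
  have hgk := fun k => contDiff_apply hg k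
  have hhk := fun k => contDiff_apply hh k
  obtain ⟨g1, g2⟩ := sum_sq_derivatives (t := Finset.univ) hgk (x := x) (by simp [hg0])
  obtain ⟨h1, h2⟩ := sum_sq_derivatives hhk hh0
  have cg : ContDiff ℝ 2 fun y => ∑ k, g y k ^ 2 := ContDiff.sum fun k _ => (hgk k).pow 2
  have ch : ContDiff ℝ 2 fun y => ∑ k ∈ s, h y k ^ 2 := ContDiff.sum fun k _ => (hhk k).pow 2
  constructor
  · have := fderiv_fun_add (cg.differentiable (by norm_num) x) (ch.differentiable (by norm_num) x)
    rw [g1, h1, add_zero] at this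
    exact this
  · intro v
    have := hess_add cg ch x
    rw [← g2, ← h2]
    exact congrArg (fun B => B v v) this

/-- The second-order sufficient condition makes the Hessian of an augmented Lagrangian positive
definite. -/
theorem exists_augmented_pos [FiniteDimensional ℝ X] {L : X → ℝ} (hL : ContDiff ℝ 2 L)
    (hg : ContDiff ℝ 2 g) (hh : ContDiff ℝ 2 h) (hg0 : g x = 0) (hh0 : ∀ k ∈ s, h x k = 0)
    (sosc : ∀ v, v ≠ 0 → fderiv ℝ g x v = 0 → (∀ k ∈ s, fderiv ℝ (fun y => h y k) x v = 0) →
      0 < hess L x v v) :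
    ∃ c : ℝ, ∀ v, v ≠ 0 → 0 < hess (fun y => L y + c * penalty g h s y) x v v := by
  set Q : X → ℝ := fun v => hess L x v v
  set R : X → ℝ := fun v => (∑ k, 2 * (fderiv ℝ (fun y => g y k) x v) ^ 2) +
        ∑ k ∈ s, 2 * (fderiv ℝ (fun y => h y k) x v) ^ 2
  have nn1 : ∀ v, 0 ≤ ∑ k, 2 * (fderiv ℝ (fun y => g y k) x v) ^ 2 := fun v =>
    Finset.sum_nonneg fun k _ => by positivity
  have nn2 : ∀ v, 0 ≤ ∑ k ∈ s, 2 * (fderiv ℝ (fun y => h y k) x v) ^ 2 := fun v =>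
    Finset.sum_nonneg fun k _ => by positivity
  -- $R$ is the Hessian form of the penalty and vanishes exactly on the directions annihilated by
  -- the constraint derivatives, where the second-order condition makes $Q$ positive.
  obtain ⟨c, hc⟩ := exists_forall_pos_add_mul (isCompact_sphere (0 : X) 1) (Q := Q) (R := R)
    (by fun_prop) (by fun_prop) (fun v => add_nonneg (nn1 v) (nn2 v)) (by
      intro v hv hR
      obtain ⟨hR1, hR2⟩ := (add_eq_zero_iff_of_nonneg (nn1 v) (nn2 v)).mp hR
      rw [Finset.sum_eq_zero_iff_of_nonneg fun k _ => by positivity] at hR1 hR2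
      refine sosc v (ne_zero_of_mem_unit_sphere ⟨v, hv⟩) ?_ fun k hk => by simpa using hR2 k hk
      ext k
      rw [← fderiv_apply_coord (hg.differentiable (by norm_num) x)]
      simpa using hR1 k (Finset.mem_univ k))
  have hform : ∀ v, hess (fun y => L y + c * penalty g h s y) x v v = Q v + c * R v := by
    intro v
    rw [hess_add hL (contDiff_const.mul (contDiff_penalty hg hh s)),
      hess_const_mul (contDiff_penalty hg hh s)]
    simp only [add_apply, smul_apply, smul_eq_mul, (penalty_derivatives hg hh hg0 hh0).2, Q, R]
  refine ⟨c, fun v hv => ?_⟩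
  -- Positivity on the unit sphere extends to all directions by homogeneity.
  have hn : ‖v‖ ≠ 0 := norm_ne_zero_iff.mpr hv
  have hu := hc (‖v‖⁻¹ • v) (by simp [norm_smul, hn])
  rw [← hform] at hu
  simp only [map_smul, smul_apply, smul_eq_mul] at hu
  have hi : 0 < ‖v‖⁻¹ := by positivity
  exact pos_of_mul_pos_right (pos_of_mul_pos_right hu hi.le) hi.le

/-- A KKT point at which the Hessian of the augmented Lagrangian is positive definite is a local
minimizer. The objective is `f` plus an affine function. -/
theorem isLocalMinOn_of_augmented [FiniteDimensional ℝ X] (hf : ContDiff ℝ 2 f)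
    (hg : ContDiff ℝ 2 g) (hh : ContDiff ℝ 2 h) (ℓ : X →L[ℝ] ℝ) (z : X) {c : ℝ} (hg0 : g x = 0)
    (hs : ∀ k ∈ s, h x k = 0 ∧ 0 < mu k) (hns : ∀ k ∉ s, mu k = 0)
    (hgrad : fderiv ℝ (lagr f g h lam mu) x + ℓ = 0)
    (hpos : ∀ v, v ≠ 0 → 0 < hess (fun y => lagr f g h lam mu y + c * penalty g h s y) x v v) :
    IsLocalMinOn (fun y => f y + ℓ (y - z)) {y | g y = 0 ∧ ∀ k, h y k ≤ 0} x := by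
  have hL : ContDiff ℝ 2 (lagr f g h lam mu) := contDiff_lagr hf hg hh lam mu
  have hp : ContDiff ℝ 2 (penalty g h s) := contDiff_penalty hg hh s
  have hA : ContDiff ℝ 2 (fun y => lagr f g h lam mu y + c * penalty g h s y) :=
    hL.add (contDiff_const.mul hp)
  have hℓ : ContDiff ℝ 2 (fun y => ℓ (y - z)) := ℓ.contDiff.comp (contDiff_id.sub contDiff_const)
  have hdiff : ∀ {φ : X → ℝ}, ContDiff ℝ 2 φ → HasFDerivAt φ (fderiv ℝ φ x) x := fun hφ =>
    (hφ.differentiable (by norm_num) x).hasFDerivAt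
  have hmin : IsLocalMin
      (fun y => (lagr f g h lam mu y + c * penalty g h s y) + ℓ (y - z)) x := by
    refine isLocalMin_of_hess_pos (hA.add hℓ) ?_ ?_
    · have h1 := ((hdiff hL).add ((hdiff hp).const_mul c)).add
        (ℓ.hasFDerivAt.comp x ((hasFDerivAt_id x).sub_const z))
      rw [(penalty_derivatives hg hh hg0 fun k hk => (hs k hk).1).1, smul_zero, add_zero,
        ContinuousLinearMap.comp_id, hgrad] at h1
      exact h1.fderiv
    · intro v hv
      rw [hess_add hA hℓ, hess_affine, add_zero]
      exact hpos v hv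
  -- On the feasible set the multiplier and penalty terms add up to $\sum_{k\in s}
  -- h_k(\mu_k+c\,h_k)$. Near $x$ the second factor is positive whatever the sign of $c$, so the sum
  -- is at most $0$. The objective thus dominates the augmented Lagrangian plus the linear term,
  -- with equality at $x$.
  have hev : ∀ᶠ y in 𝓝 x, ∀ k ∈ s, 0 < mu k + c * h y k := by
    rw [Filter.eventually_all_finset]
    intro k hk
    have hc : ContinuousAt (fun y => mu k + c * h y k) x :=
      (continuous_const.add (continuous_const.mul (contDiff_apply hh k).continuous)).continuousAt
    refine hc.eventually (lt_mem_nhds ?_)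
    simpa [(hs k hk).1] using (hs k hk).2
  have hmu : ∀ y, inner ℝ mu (h y) = ∑ k ∈ s, mu k * h y k := by
    intro y
    rw [PiLp.inner_apply, ← Finset.sum_subset (Finset.subset_univ s)
      (fun k _ hk => by simp [hns k hk])]
    exact Finset.sum_congr rfl fun k _ => by simp [mul_comm]
  refine eventually_nhdsWithin_iff.mpr ?_
  filter_upwards [hmin, hev] with y hy hk hfeas
  obtain ⟨hgy, hhy⟩ := hfeas
  have hle : ∑ k ∈ s, h y k * (mu k + c * h y k) ≤ 0 :=
    Finset.sum_nonpos fun k hks => mul_nonpos_of_nonpos_of_nonneg (hhy k) (hk k hks).le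
  have hsplit : ∑ k ∈ s, h y k * (mu k + c * h y k) =
      (∑ k ∈ s, mu k * h y k) + c * ∑ k ∈ s, h y k ^ 2 := by
    rw [Finset.mul_sum, ← Finset.sum_add_distrib]
    exact Finset.sum_congr rfl fun k _ => by ring
  have hx1 : ∑ k ∈ s, mu k * h x k = 0 :=
    Finset.sum_eq_zero fun k hks => by rw [(hs k hks).1, mul_zero]
  have hx2 : ∑ k ∈ s, h x k ^ 2 = 0 :=
    Finset.sum_eq_zero fun k hks => by rw [(hs k hks).1]; norm_num
  simp only [lagr, penalty, hmu, hgy, hg0, inner_zero_right, PiLp.zero_apply, hx1, hx2, ne_eq,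
    OfNat.ofNat_ne_zero, not_false_eq_true, zero_pow, Finset.sum_const_zero, add_zero, zero_add,
    mul_zero] at hy
  linarith

end SingleProgram

/-! ### Nonsingularity of the KKT Jacobian. -/

section KKTMap

variable {X : Type*} [NormedAddCommGroup X] [InnerProductSpace ℝ X] {a b : ℕ}

/-- The inner product of `E a` as a linear map into the dual. -/
noncomputable def pairing (a : ℕ) : E a →L[ℝ] E a →L[ℝ] ℝ :=
  ∑ k, (EuclideanSpace.proj k : E a →L[ℝ] ℝ).smulRight (EuclideanSpace.proj k : E a →L[ℝ] ℝ)

theorem pairing_apply (l v : E a) : pairing a l v = ∑ k, l k * v k := by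
  simp [pairing, sum_apply]

theorem inner_eq_pairing (l v : E a) : inner ℝ l v = pairing a l v := by
  rw [pairing_apply, PiLp.inner_apply]
  exact Finset.sum_congr rfl fun k _ => by simp [mul_comm]

/-- The Riesz representation as a real linear map. -/
noncomputable def riesz (X : Type*) [NormedAddCommGroup X] [InnerProductSpace ℝ X]
    [CompleteSpace X] : (X →L[ℝ] ℝ) →L[ℝ] X where
  toFun := (InnerProductSpace.toDual ℝ X).symm
  map_add' := map_add _
  map_smul' := fun c l => by simp
  cont := (InnerProductSpace.toDual ℝ X).symm.continuous

theorem riesz_fderiv [CompleteSpace X] (φ : X → ℝ) (x : X) :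
    gradient φ x = riesz X (fderiv ℝ φ x) :=
  rfl

theorem riesz_eq_zero [CompleteSpace X] {l : X →L[ℝ] ℝ} (hl : riesz X l = 0) : l = 0 :=
  (InnerProductSpace.toDual ℝ X).symm.injective (hl.trans (map_zero _).symm)

theorem inner_riesz [CompleteSpace X] (l : X →L[ℝ] ℝ) (x : X) : inner ℝ (riesz X l) x = l x :=
  InnerProductSpace.toDual_symm_apply

/-- The equalities of the KKT conditions; `w` is the gradient of an additional linear term of the
objective. -/
noncomputable def kktMap [CompleteSpace X] (f : X → ℝ) (g : X → E a) (h : X → E b) (w : X)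
    (q : X × E a × E b) :
    X × E a × E b :=
  (gradient (lagr f g h q.2.1 q.2.2) q.1 + w, g q.1,
    WithLp.toLp 2 (fun k => q.2.2 k * h q.1 k))

variable {f : X → ℝ} {g : X → E a} {h : X → E b}

theorem fderiv_lagr (hf : Differentiable ℝ f) (hg : Differentiable ℝ g) (hh : Differentiable ℝ h)
    (lam : E a) (mu : E b) (y : X) :
    fderiv ℝ (lagr f g h lam mu) y =
      fderiv ℝ f y + (pairing a lam) ∘L fderiv ℝ g y + (pairing b mu) ∘L fderiv ℝ h y := by
  unfold lagr
  simp only [inner_eq_pairing]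
  exact
  (((hf y).hasFDerivAt.add ((pairing a lam).hasFDerivAt.comp y (hg y).hasFDerivAt)).add
    ((pairing b mu).hasFDerivAt.comp y (hh y).hasFDerivAt)).fderiv

/-- Under strict complementarity, the second-order sufficient condition and linear independence of
the active constraint gradients, the Jacobian of the KKT map is injective. -/
theorem kktMap_fderiv_injective [CompleteSpace X] (hf : ContDiff ℝ 2 f)
    (hg : ContDiff ℝ 2 g) (hh : ContDiff ℝ 2 h) (w : X) {q : X × E a × E b}
    (compl : ∀ k, q.2.2 k * h q.1 k = 0)
    (strict : ∀ k, h q.1 k = 0 → 0 < q.2.2 k)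
    (sosc : ∀ v, v ≠ 0 → fderiv ℝ g q.1 v = 0 →
      (∀ k, h q.1 k = 0 → fderiv ℝ (fun y => h y k) q.1 v = 0) →
      0 < hess (lagr f g h q.2.1 q.2.2) q.1 v v)
    (licq : LinearIndependent ℝ (Sum.elim (fun k => fderiv ℝ (fun y => g y k) q.1)
      (fun k : {k // h q.1 k = 0} => fderiv ℝ (fun y => h y k.1) q.1))) :
    DifferentiableAt ℝ (kktMap f g h w) q ∧
      ∀ v, fderiv ℝ (kktMap f g h w) q v = 0 → v = 0 := by
  obtain ⟨x, lam, mu⟩ := q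
  simp only at compl strict sosc licq
  have hfd : Differentiable ℝ f := hf.differentiable (by norm_num)
  have hgd : Differentiable ℝ g := hg.differentiable (by norm_num)
  have hhd : Differentiable ℝ h := hh.differentiable (by norm_num)
  set q : X × E a × E b := (x, lam, mu)
  have p1 : HasFDerivAt (fun q : X × E a × E b => q.1) (.fst ℝ X (E a × E b)) q := hasFDerivAt_fst
  have p2 : HasFDerivAt (fun q : X × E a × E b => q.2.1)
      ((ContinuousLinearMap.fst ℝ (E a) (E b)) ∘L .snd ℝ X (E a × E b)) q :=
    HasFDerivAt.fst hasFDerivAt_snd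
  have p3 : HasFDerivAt (fun q : X × E a × E b => q.2.2)
      ((ContinuousLinearMap.snd ℝ (E a) (E b)) ∘L .snd ℝ X (E a × E b)) q :=
    HasFDerivAt.snd hasFDerivAt_snd
  have c2 : HasFDerivAt (fun q : X × E a × E b => pairing a q.2.1) _ q :=
    (pairing a).hasFDerivAt.comp q p2
  have c3 : HasFDerivAt (fun q : X × E a × E b => pairing b q.2.2) _ q :=
    (pairing b).hasFDerivAt.comp q p3
  have b1 : HasFDerivAt (fun q : X × E a × E b => fderiv ℝ f q.1) _ q :=
    HasFDerivAt.comp (g := fderiv ℝ f) q (hasFDerivAt_fderiv hf x) p1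
  have b2 : HasFDerivAt (fun q : X × E a × E b => fderiv ℝ g q.1) _ q :=
    HasFDerivAt.comp (g := fderiv ℝ g) q (hasFDerivAt_fderiv hg x) p1
  have b3 : HasFDerivAt (fun q : X × E a × E b => fderiv ℝ h q.1) _ q :=
    HasFDerivAt.comp (g := fderiv ℝ h) q (hasFDerivAt_fderiv hh x) p1
  have d1 := (b1.add (c2.clm_comp b2)).add (c3.clm_comp b3)
  have d1' : (fun q : X × E a × E b => fderiv ℝ (lagr f g h q.2.1 q.2.2) q.1) = _ :=
    funext fun q => fderiv_lagr hfd hgd hhd q.2.1 q.2.2 q.1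
  replace d1 := d1.congr_of_eventuallyEq (Filter.EventuallyEq.of_eq d1')
  set D := fderiv ℝ (fun q : X × E a × E b => fderiv ℝ (lagr f g h q.2.1 q.2.2) q.1) q with hD
  -- Restricting to a slice with fixed multipliers identifies this block with the Hessian of the
  -- Lagrangian without expanding it.
  have hDx : ∀ v, D (v, 0, 0) = hess (lagr f g h lam mu) x v := by
    intro v
    have := HasFDerivAt.comp (f := fun y => (y, lam, mu)) x (hD ▸ d1.differentiableAt.hasFDerivAt)
      (hasFDerivAt_prodMk_left x (lam, mu))
    exact congrArg (fun T => T v) this.fderiv.symm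
  have hDm : ∀ l m, D (0, l, m) = pairing a l ∘L fderiv ℝ g x + pairing b m ∘L fderiv ℝ h x := by
    intro l m
    rw [hD, d1.fderiv]
    ext y
    simp [q]
  have e1 : HasFDerivAt (fun q : X × E a × E b => gradient (lagr f g h q.2.1 q.2.2) q.1 + w)
      (riesz X ∘L D) q :=
    ((riesz X).hasFDerivAt.comp q d1.differentiableAt.hasFDerivAt).add_const w
  have e2 : HasFDerivAt (fun q : X × E a × E b => g q.1) (fderiv ℝ g x ∘L .fst ℝ X (E a × E b)) q :=
    HasFDerivAt.comp (g := g) q (hgd x).hasFDerivAt p1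
  have k1 : ∀ k, HasFDerivAt (fun q : X × E a × E b => q.2.2 k) _ q := fun k =>
    (EuclideanSpace.proj k : E b →L[ℝ] ℝ).hasFDerivAt.comp q p3
  have k2 : ∀ k, HasFDerivAt (fun q : X × E a × E b => h q.1 k) _ q := fun k =>
    HasFDerivAt.comp (g := fun y => h y k) q
      ((contDiff_apply hh k).differentiable (by norm_num) x).hasFDerivAt p1
  have hk : ∀ k, HasFDerivAt (fun q : X × E a × E b => q.2.2 k * h q.1 k) _ q := fun k =>
    (k1 k).mul (k2 k)
  have e3 : DifferentiableAt ℝ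
      (fun q : X × E a × E b => (WithLp.toLp 2 (fun k => q.2.2 k * h q.1 k) : E b)) q :=
    differentiableAt_euclidean.mpr fun k => (hk k).differentiableAt
  have e := e1.prodMk (e2.prodMk e3.hasFDerivAt)
  refine ⟨e.differentiableAt, ?_⟩
  rintro ⟨v, l, m⟩ hv
  have hv' := (congrArg (fun T => T (v, l, m)) e.fderiv).symm.trans hv
  simp only [ContinuousLinearMap.prod_apply, Prod.mk_eq_zero] at hv'
  obtain ⟨hv1, hv2, hv3⟩ := hv'
  have hv1' : D (v, l, m) = 0 :=
    riesz_eq_zero hv1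
  have hv2' : fderiv ℝ g x v = 0 := hv2
  have hv3' : ∀ k, mu k * fderiv ℝ (fun y => h y k) x v + h x k * m k = 0 := by
    intro k
    have h1 := fderiv_apply_coord e3 k (v, l, m)
    rw [hv3] at h1
    have h2 := (congrArg (fun T => T (v, l, m)) (hk k).fderiv).symm.trans h1
    simpa [q] using h2
  -- The linearized complementarity row splits by activity: active constraints make $v$ tangent,
  -- inactive ones force $m_k=0$.
  have hact : ∀ k, h x k = 0 → fderiv ℝ (fun y => h y k) x v = 0 := by
    intro k hk0
    have := hv3' k
    rw [hk0, zero_mul, add_zero] at this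
    exact (mul_eq_zero.mp this).resolve_left (strict k hk0).ne'
  have hinact : ∀ k, h x k ≠ 0 → m k = 0 := by
    intro k hk0
    have := hv3' k
    rw [(mul_eq_zero.mp (compl k)).resolve_right hk0, zero_mul, zero_add] at this
    exact (mul_eq_zero.mp this).resolve_left hk0
  have hsum : hess (lagr f g h lam mu) x v +
      (pairing a l ∘L fderiv ℝ g x + pairing b m ∘L fderiv ℝ h x) = 0 := by
    rw [← hDx, ← hDm, ← map_add]
    simpa using hv1'
  -- Testing the stationarity row against $v$ removes all constraint terms and leaves
  -- $\nabla^2L(v,v)=0$, against the second-order condition.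
  have hv0 : v = 0 := by
    by_contra hne
    have hpos := sosc v hne hv2' hact
    have := congrArg (fun T => T v) hsum
    simp only [add_apply, ContinuousLinearMap.comp_apply, hv2', map_zero, zero_add,
      zero_apply, pairing_apply] at this
    rw [Finset.sum_eq_zero, add_zero] at this
    · exact hpos.ne' this
    · intro k _
      rw [← fderiv_apply_coord (hhd x)]
      by_cases hk0 : h x k = 0
      · simp [hact k hk0]
      · simp [hinact k hk0]
  subst hv0
  rw [map_zero, zero_add] at hsum
  classical
  -- With $v=0$ the stationarity row is a vanishing linear combination of equality and active
  -- constraint gradients.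
  have hlin : ∀ u : {k // h x k = 0} → ℝ, (∀ k, u k = m k) →
      ∑ k, Sum.elim (fun k => l k) u k • Sum.elim (fun k => fderiv ℝ (fun y => g y k) x)
      (fun k : {k // h x k = 0} => fderiv ℝ (fun y => h y k.1) x) k = 0 := by
    intro u hu
    ext y
    have h1 := congrArg (fun T => T y) hsum
    simp only [add_apply, ContinuousLinearMap.comp_apply, zero_apply, pairing_apply] at h1
    rw [← Fintype.sum_subtype_add_sum_subtype (fun k => h x k = 0)
      (fun k => m k * fderiv ℝ h x y k), Finset.sum_eq_zero (s := Finset.univ)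
      (f := fun k : {k // ¬ h x k = 0} => _) (fun k _ => by simp [hinact k.1 k.2])] at h1
    simp only [Fintype.sum_sum_type, Sum.elim_inl, Sum.elim_inr, add_apply,
      sum_apply, smul_apply, smul_eq_mul, zero_apply,
      fderiv_apply_coord (hgd x), fderiv_apply_coord (hhd x), hu]
    simpa [mul_comm] using h1
  have hz := Fintype.linearIndependent_iff.mp licq _ (hlin _ fun _ => rfl)
  have hl : l = 0 := by
    ext k
    exact hz (Sum.inl k)
  have hm : m = 0 := by
    ext k
    by_cases hk0 : h x k = 0
    · exact hz (Sum.inr ⟨k, hk0⟩)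
    · exact hinact k hk0
  rw [hl, hm]
  rfl

end KKTMap

/-! ### Mixed partial derivatives of coupling functions. -/

section Partial

variable {X Y Z : Type*} [NormedAddCommGroup X] [NormedSpace ℝ X]
  [NormedAddCommGroup Y] [NormedSpace ℝ Y] [NormedAddCommGroup Z] [NormedSpace ℝ Z]
  {φ : X → Y → Z}

theorem fderiv_left_eq (hφ : ContDiff ℝ 3 (Function.uncurry φ)) (x : X) (y : Y) :
    fderiv ℝ (fun x' => φ x' y) x = fderiv ℝ (Function.uncurry φ) (x, y) ∘L .inl ℝ X Y :=
  (HasFDerivAt.comp (g := Function.uncurry φ) (f := fun x' => (x', y)) x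
    (hφ.differentiable (by norm_num) (x, y)).hasFDerivAt (hasFDerivAt_prodMk_left x y)).fderiv

theorem dY_eq (hφ : ContDiff ℝ 3 (Function.uncurry φ)) (x : X) (y : Y) :
    dY φ x y = fderiv ℝ (Function.uncurry φ) (x, y) ∘L .inr ℝ X Y :=
  (HasFDerivAt.comp (g := Function.uncurry φ) (f := fun y' => (x, y')) y
    (hφ.differentiable (by norm_num) (x, y)).hasFDerivAt (hasFDerivAt_prodMk_right x y)).fderiv

theorem dXY_apply (hφ : ContDiff ℝ 3 (Function.uncurry φ)) (x : X) (y : Y) (s : X) (t : Y) :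
    dXY φ x y s t = hess (Function.uncurry φ) (x, y) (s, 0) (0, t) := by
  have h1 := HasFDerivAt.comp (f := fun x' : X => (x', y)) x
    (hasFDerivAt_fderiv (hφ.of_le (by norm_num)) (x, y)) (hasFDerivAt_prodMk_left x y)
  have h2 := h1.clm_comp (hasFDerivAt_const (ContinuousLinearMap.inr ℝ X Y) x)
  rw [dXY, show (fun x' => dY φ x' y) = _ from funext fun x' => dY_eq hφ x' y]
  refine (congrArg (fun T => T s t) h2.fderiv).trans ?_
  simp

theorem dYY_apply (hφ : ContDiff ℝ 3 (Function.uncurry φ)) (x : X) (y : Y) (s t : Y) :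
    dYY φ x y s t = hess (Function.uncurry φ) (x, y) (0, s) (0, t) := by
  have h1 := HasFDerivAt.comp (f := fun y' : Y => (x, y')) y
    (hasFDerivAt_fderiv (hφ.of_le (by norm_num)) (x, y)) (hasFDerivAt_prodMk_right x y)
  have h2 := h1.clm_comp (hasFDerivAt_const (ContinuousLinearMap.inr ℝ X Y) y)
  rw [dYY, hess, show (fun y' => fderiv ℝ (φ x) y') = _ from funext fun y' => dY_eq hφ x y']
  refine (congrArg (fun T => T s t) h2.fderiv).trans ?_
  simp

/-- `dXY` differentiates in $y$ first, whereas here $x$ comes first; symmetry of the second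
derivative exchanges the two. -/
theorem hasFDerivAt_fderiv_left_zero (hφ : ContDiff ℝ 3 (Function.uncurry φ)) {x : X} {y : Y}
    (h0 : dXY φ x y = 0) :
    HasFDerivAt (fun y' => fderiv ℝ (fun x' => φ x' y') x) (0 : Y →L[ℝ] X →L[ℝ] Z) y := by
  have h1 := HasFDerivAt.comp (f := fun y' : Y => (x, y')) y
    (hasFDerivAt_fderiv (hφ.of_le (by norm_num)) (x, y)) (hasFDerivAt_prodMk_right x y)
  have h2 := h1.clm_comp (hasFDerivAt_const (ContinuousLinearMap.inl ℝ X Y) y)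
  rw [show (fun y' => fderiv ℝ (fun x' => φ x' y') x) = _ from
    funext fun y' => fderiv_left_eq hφ x y']
  refine h2.congr_fderiv ?_
  ext t s
  have hsymm : IsSymmSndFDerivAt ℝ (Function.uncurry φ) (x, y) :=
    hφ.contDiffAt.isSymmSndFDerivAt (by simp; norm_num)
  have h3 := dXY_apply hφ x y s t
  rw [h0] at h3
  have h4 : hess (Function.uncurry φ) (x, y) (0, t) (s, 0) = 0 :=
    (hsymm (0, t) (s, 0)).trans h3.symm
  simpa using h4

/-- The increment splits as $(s,0)+(0,t)$, so the mixed and the pure second derivative together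
control the full derivative. -/
theorem hasFDerivAt_dY_zero (hφ : ContDiff ℝ 3 (Function.uncurry φ)) {x : X} {y : Y}
    (h0 : dXY φ x y = 0) (h1 : dYY φ x y = 0) :
    HasFDerivAt (fun z : X × Y => dY φ z.1 z.2) (0 : X × Y →L[ℝ] Y →L[ℝ] Z) (x, y) := by
  have h2 := (hasFDerivAt_fderiv (hφ.of_le (by norm_num)) (x, y)).clm_comp
    (hasFDerivAt_const (ContinuousLinearMap.inr ℝ X Y) (x, y))
  rw [show (fun z : X × Y => dY φ z.1 z.2) = _ from funext fun z => dY_eq hφ z.1 z.2]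
  refine h2.congr_fderiv ?_
  refine ContinuousLinearMap.ext fun ⟨s, t⟩ => ContinuousLinearMap.ext fun u => ?_
  have h3 := dXY_apply hφ x y s u
  have h4 := dYY_apply hφ x y t u
  rw [h0] at h3
  rw [h1] at h4
  have h5 : hess (Function.uncurry φ) (x, y) (s, t) (0, u) = 0 := by
    rw [show ((s, t) : X × Y) = (s, 0) + (0, t) by simp, map_add, add_apply, ← h3, ← h4]
    simp
  simpa using h5

/-- Continuity of the Hessian in parameters. -/
theorem continuous_hess {ψ : X → Y → Z} (hψ : ContDiff ℝ 3 (Function.uncurry ψ)) {y : X → Y}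
    (hy : ContDiff ℝ 3 y) : Continuous (fun w => hess (ψ w) (y w)) := by
  have h1 : ContDiff ℝ 2 (Function.uncurry fun w y' => fderiv ℝ (ψ w) y') :=
    ContDiff.fderiv (f := fun (z : X × Y) y' => ψ z.1 y') (g := Prod.snd) (m := 3) (n := 2)
      (hψ.comp ((contDiff_fst.comp contDiff_fst).prodMk contDiff_snd)) contDiff_snd (by norm_num)
  exact (ContDiff.fderiv (m := 2) (n := 1) h1 (hy.of_le (by norm_num)) (by norm_num)).continuous

end Partial

/-! ### Smoothness of the program data in all parameters. -/

namespace NeighborAffineNLP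

variable {M : ℕ} (P : NeighborAffineNLP M)

theorem mem_nbrs {i j : Fin M} : j ∈ P.nbrs i ↔ P.graph.Adj i j := by
  simp [nbrs]

section Smooth

variable {V : Type*} [NormedAddCommGroup V] [NormedSpace ℝ V]

theorem contDiff_coupled {Z : Type*} [NormedAddCommGroup Z] [NormedSpace ℝ Z] (i : Fin M)
    {l : E (P.n i) → Z} {φ : ∀ j, E (P.n i) → E (P.n j) → Z} (hl : ContDiff ℝ 3 l)
    (hφ : ∀ j, P.graph.Adj i j → ContDiff ℝ 3 (Function.uncurry (φ j)))
    {y : V → E (P.n i)} {x : V → P.XVar} (hy : ContDiff ℝ 3 y) (hx : ContDiff ℝ 3 x) :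
    ContDiff ℝ 3 (fun v => l (y v) + ∑ j ∈ P.nbrs i, φ j (y v) (x v j)) :=
  (hl.comp hy).add (ContDiff.sum fun j hj =>
    (hφ j (P.mem_nbrs.mp hj)).comp (hy.prodMk (contDiff_pi.mp hx j)))

variable {i : Fin M} {y : V → E (P.n i)} {x : V → P.XVar}

theorem contDiff_f (hy : ContDiff ℝ 3 y) (hx : ContDiff ℝ 3 x) :
    ContDiff ℝ 3 (fun v => P.f i (y v) (x v)) :=
  P.contDiff_coupled i (P.fLoc_smooth i) (P.fCpl_smooth i) hy hx

theorem contDiff_g (hy : ContDiff ℝ 3 y) (hx : ContDiff ℝ 3 x) :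
    ContDiff ℝ 3 (fun v => P.g i (y v) (x v)) :=
  P.contDiff_coupled i (P.gLoc_smooth i) (P.gCpl_smooth i) hy hx

theorem contDiff_h (hy : ContDiff ℝ 3 y) (hx : ContDiff ℝ 3 x) :
    ContDiff ℝ 3 (fun v => P.h i (y v) (x v)) :=
  P.contDiff_coupled i (P.hLoc_smooth i) (P.hCpl_smooth i) hy hx

theorem contDiff_lag {l : V → E (P.ng i)} {m : V → E (P.nh i)} (hy : ContDiff ℝ 3 y)
    (hl : ContDiff ℝ 3 l) (hm : ContDiff ℝ 3 m) (hx : ContDiff ℝ 3 x) :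
    ContDiff ℝ 3 (fun v => P.lag i (y v) (l v) (m v) (x v)) :=
  ((P.contDiff_f hy hx).add (hl.inner ℝ (P.contDiff_g hy hx))).add
    (hm.inner ℝ (P.contDiff_h hy hx))

variable {p : V → P.Var}

theorem contDiff_xOf {k : WithTop ℕ∞} (hp : ContDiff ℝ k p) :
    ContDiff ℝ k (fun v => P.xOf (p v)) :=
  contDiff_pi.mpr fun i => (contDiff_pi.mp hp i).fst

theorem contDiff_update {x : V → P.XVar} (hx : ContDiff ℝ 3 x) (hy : ContDiff ℝ 3 y) :
    ContDiff ℝ 3 (fun v => Function.update (x v) i (y v)) := by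
  refine contDiff_pi.mpr fun j => ?_
  by_cases hj : j = i
  · subst hj
    simpa using hy
  · simpa [hj] using contDiff_pi.mp hx j

theorem contDiff_sens (hp : ContDiff ℝ 3 p) (i j : Fin M) :
    ContDiff ℝ 2 (fun v => P.sens (p v) i j) := by
  have hp' : ∀ j, ContDiff ℝ 3 fun v => p v j := contDiff_pi.mp hp
  have hpj : ContDiff ℝ 3 fun z : V × E (P.n i) => p z.1 j := (hp' j).comp contDiff_fst
  refine (riesz _).contDiff.comp (ContDiff.fderiv (m := 3) (n := 2)
    (f := fun v y => P.lag j (p v j).1 (p v j).2.1 (p v j).2.2 (Function.update (P.xOf (p v)) i y))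
    (g := fun v => (p v i).1)
    (P.contDiff_lag hpj.fst hpj.snd.fst hpj.snd.snd ?_) ((hp' i).fst.of_le (by norm_num))
    (by norm_num))
  exact P.contDiff_update (P.contDiff_xOf (hp.comp contDiff_fst)) contDiff_snd

/-- The gradients cost one of the three derivatives; the two that remain are what the quadratic
bound needs. -/
theorem contDiff_Fhat {prev : V → P.Var} (hp : ContDiff ℝ 3 p) (hprev : ContDiff ℝ 3 prev) :
    ContDiff ℝ 2 (fun v => P.Fhat (p v) (prev v)) := by
  refine contDiff_pi.mpr fun i => ?_
  have hpi : ContDiff ℝ 3 fun v => p v i := contDiff_pi.mp hp i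
  have hx : ContDiff ℝ 3 fun v => P.xOf (prev v) := P.contDiff_xOf hprev
  have hpi' : ContDiff ℝ 3 fun z : V × E (P.n i) => p z.1 i := hpi.comp contDiff_fst
  refine ContDiff.prodMk (ContDiff.add ?_ (ContDiff.sum fun j _ => P.contDiff_sens hprev i j))
    (((P.contDiff_g hpi.fst hx).of_le (by norm_num)).prodMk (contDiff_euclidean.mpr fun k => ?_))
  · exact (riesz _).contDiff.comp (ContDiff.fderiv (m := 3) (n := 2) (f := fun v y => P.lag i y
      (p v i).2.1 (p v i).2.2 (P.xOf (prev v))) (g := fun v => (p v i).1)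
      (P.contDiff_lag contDiff_snd hpi'.snd.fst hpi'.snd.snd (hx.comp contDiff_fst))
      (hpi.fst.of_le (by norm_num)) (by norm_num))
  · exact ((contDiff_apply hpi.snd.snd k).mul
      (contDiff_apply (P.contDiff_h hpi.fst hx) k)).of_le (by norm_num)

end Smooth

/-! ### First-order independence of the previous iterate. -/

section Vanishing

variable {P}

/-- Derivative in `y` of a coupled function in which agent `i` is a neighbor with value `y`. -/
theorem fderiv_coupled_update {Z : Type*} [NormedAddCommGroup Z] [NormedSpace ℝ Z] {i j : Fin M}
    (hij : i ∈ P.nbrs j) (A : Z) (φ : ∀ l, E (P.n l) → Z) (x : P.XVar) (y : E (P.n i)) :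
    fderiv ℝ (fun y => A + ∑ l ∈ P.nbrs j, φ l (Function.update x i y l)) y =
      fderiv ℝ (φ i) y := by
  have h1 : (fun y => A + ∑ l ∈ P.nbrs j, φ l (Function.update x i y l)) =
      fun y => φ i y + (A + ∑ l ∈ (P.nbrs j).erase i, φ l (x l)) := by
    ext1 y
    rw [← Finset.add_sum_erase _ _ hij, Function.update_self, add_left_comm]
    congr 2
    exact Finset.sum_congr rfl fun l hl => by
      rw [Function.update_of_ne (Finset.ne_of_mem_erase hl)]
  rw [h1, fderiv_add_const]

theorem hasFDerivAt_coord {Z : Type*} [NormedAddCommGroup Z] [NormedSpace ℝ Z] {j : Fin M}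
    {φ : E (P.n j) × E (P.ng j) × E (P.nh j) → Z} {p : P.Var}
    (h : HasFDerivAt φ (0 : E (P.n j) × E (P.ng j) × E (P.nh j) →L[ℝ] Z) (p j)) :
    HasFDerivAt (fun p : P.Var => φ (p j)) (0 : P.Var →L[ℝ] Z) p := by
  have := HasFDerivAt.comp (g := φ) (f := fun p : P.Var => p j) p h (hasFDerivAt_apply j p)
  rwa [ContinuousLinearMap.zero_comp] at this

theorem hasFDerivAt_xcoord {Z : Type*} [NormedAddCommGroup Z] [NormedSpace ℝ Z] {j : Fin M}
    {φ : E (P.n j) → Z} {p : P.Var} (h : HasFDerivAt φ (0 : E (P.n j) →L[ℝ] Z) (p j).1) :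
    HasFDerivAt (fun p : P.Var => φ (p j).1) (0 : P.Var →L[ℝ] Z) p := by
  refine hasFDerivAt_coord (φ := fun q => φ q.1) ?_
  have := HasFDerivAt.comp (g := φ) (p j) h hasFDerivAt_fst
  rwa [ContinuousLinearMap.zero_comp] at this

/-- The derivative in `x_i` of a coupled function does not depend on the neighbors to first
order. -/
theorem hasFDerivAt_fderiv_coupled {Z : Type*} [NormedAddCommGroup Z] [NormedSpace ℝ Z]
    {i : Fin M} {l : E (P.n i) → Z} {φ : ∀ j, E (P.n i) → E (P.n j) → Z} (hl : ContDiff ℝ 3 l)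
    (hφ : ∀ j, P.graph.Adj i j → ContDiff ℝ 3 (Function.uncurry (φ j))) {y : E (P.n i)}
    {p : P.Var} (h0 : ∀ j, P.graph.Adj i j → dXY (φ j) y (p j).1 = 0) :
    HasFDerivAt (fun p : P.Var => fderiv ℝ (fun y => l y + ∑ j ∈ P.nbrs i, φ j y (P.xOf p j)) y)
      (0 : P.Var →L[ℝ] E (P.n i) →L[ℝ] Z) p := by
  have h1 : (fun p : P.Var => fderiv ℝ (fun y => l y + ∑ j ∈ P.nbrs i, φ j y (P.xOf p j)) y) =
      fun p : P.Var => fderiv ℝ l y + ∑ j ∈ P.nbrs i, fderiv ℝ (fun y => φ j y (p j).1) y := by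
    ext1 p
    refine HasFDerivAt.fderiv ((hl.differentiable (by norm_num) y).hasFDerivAt.add
      (HasFDerivAt.fun_sum fun j hj => ?_))
    exact (((hφ j (P.mem_nbrs.mp hj)).comp (contDiff_prodMk_left (p j).1)).differentiable
      (by norm_num) y).hasFDerivAt
  rw [h1]
  have h2 := (hasFDerivAt_const (fderiv ℝ l y) p).add (HasFDerivAt.fun_sum (u := P.nbrs i)
    fun j hj => hasFDerivAt_xcoord (P := P) (p := p) (hasFDerivAt_fderiv_left_zero
      (hφ j (P.mem_nbrs.mp hj)) (h0 j (P.mem_nbrs.mp hj))))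
  rw [Finset.sum_const_zero, add_zero] at h2
  exact h2

theorem hasFDerivAt_coupled {Z : Type*} [NormedAddCommGroup Z] [NormedSpace ℝ Z]
    {i : Fin M} {l : E (P.n i) → Z} {φ : ∀ j, E (P.n i) → E (P.n j) → Z}
    (hφ : ∀ j, P.graph.Adj i j → ContDiff ℝ 3 (Function.uncurry (φ j))) {y : E (P.n i)}
    {p : P.Var} (h0 : ∀ j, P.graph.Adj i j → dY (φ j) y (p j).1 = 0) :
    HasFDerivAt (fun p : P.Var => l y + ∑ j ∈ P.nbrs i, φ j y (P.xOf p j))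
      (0 : P.Var →L[ℝ] Z) p := by
  have h2 := (hasFDerivAt_const (l y) p).add (HasFDerivAt.fun_sum (u := P.nbrs i)
    fun j hj => hasFDerivAt_xcoord (P := P) (p := p) (φ := φ j y) (by
      have h3 : HasFDerivAt (φ j y) (dY (φ j) y (p j).1) (p j).1 :=
        (((hφ j (P.mem_nbrs.mp hj)).comp (contDiff_prodMk_right y)).differentiable
          (by norm_num) _).hasFDerivAt
      rwa [h0 j (P.mem_nbrs.mp hj)] at h3))
  rw [Finset.sum_const_zero, add_zero] at h2
  exact h2

/-- The product rule leaves only the term that differentiates $l$. The first alternative serves the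
sensitivities, where multipliers vary but the coupling derivative is zero; the second serves an
agent's own Lagrangian, whose multipliers are held fixed. -/
theorem hasFDerivAt_pairing_comp {V Y : Type*} [NormedAddCommGroup V] [NormedSpace ℝ V]
    [NormedAddCommGroup Y] [NormedSpace ℝ Y] {a : ℕ} {l : V → E a} {T : V → Y →L[ℝ] E a} {v : V}
    (hl : DifferentiableAt ℝ l v) (hT : HasFDerivAt T (0 : V →L[ℝ] Y →L[ℝ] E a) v)
    (h0 : T v = 0 ∨ fderiv ℝ l v = 0) :
    HasFDerivAt (fun v => pairing a (l v) ∘L T v) (0 : V →L[ℝ] Y →L[ℝ] ℝ) v := by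
  have h1 : HasFDerivAt (fun v => pairing a (l v)) _ v :=
    (pairing a).hasFDerivAt.comp v hl.hasFDerivAt
  refine (h1.clm_comp hT).congr_fderiv ?_
  ext t u
  rcases h0 with h0 | h0 <;> simp [h0]

/-- In $L_j$ only the coupling terms with index $i$ depend on $x_i$, so the sensitivity reduces to
the derivatives `dY` that the coupling assumptions address. -/
theorem sens_eq {p : P.Var} {i j : Fin M} (hij : P.graph.Adj j i) :
    P.sens p i j = riesz _ (dY (P.fCpl j i) (p j).1 (p i).1 +
      pairing _ (p j).2.1 ∘L dY (P.gCpl j i) (p j).1 (p i).1 +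
      pairing _ (p j).2.2 ∘L dY (P.hCpl j i) (p j).1 (p i).1) := by
  have hmem : i ∈ P.nbrs j := P.mem_nbrs.mpr hij
  have hu : ContDiff ℝ 3 fun y : E (P.n i) => Function.update (P.xOf p) i y :=
    P.contDiff_update contDiff_const contDiff_id
  have h1 := fderiv_lagr ((P.contDiff_f (i := j) (contDiff_const (c := (p j).1)) hu).differentiable
    (by norm_num)) ((P.contDiff_g (i := j) (contDiff_const (c := (p j).1)) hu).differentiable
    (by norm_num)) ((P.contDiff_h (i := j) (contDiff_const (c := (p j).1)) hu).differentiable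
    (by norm_num)) (p j).2.1 (p j).2.2 (p i).1
  refine congrArg (riesz _) (h1.trans ?_)
  congr 1
  · congr 1
    · exact fderiv_coupled_update hmem _ (fun l => P.fCpl j l (p j).1) _ _
    · exact congrArg _ (fderiv_coupled_update hmem _ (fun l => P.gCpl j l (p j).1) _ _)
  · exact congrArg _ (fderiv_coupled_update hmem _ (fun l => P.hCpl j l (p j).1) _ _)

theorem hasFDerivAt_sens {p : P.Var} (hc : P.CouplingVanishes (P.xOf p)) {i j : Fin M}
    (hij : P.graph.Adj j i) :
    HasFDerivAt (fun p => P.sens p i j) (0 : P.Var →L[ℝ] E (P.n i)) p := by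
  rw [show (fun p => P.sens p i j) = _ from funext fun p => sens_eq hij]
  have hz : HasFDerivAt (fun p : P.Var => ((p j).1, (p i).1)) _ p :=
    (HasFDerivAt.fst (hasFDerivAt_apply (𝕜 := ℝ) j p)).prodMk
      (HasFDerivAt.fst (hasFDerivAt_apply (𝕜 := ℝ) i p))
  have hd : ∀ {Z : Type} [NormedAddCommGroup Z] [NormedSpace ℝ Z]
      {φ : E (P.n j) → E (P.n i) → Z}, ContDiff ℝ 3 (Function.uncurry φ) →
      dXY φ (p j).1 (p i).1 = 0 → dYY φ (p j).1 (p i).1 = 0 →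
      HasFDerivAt (fun p : P.Var => dY φ (p j).1 (p i).1)
        (0 : P.Var →L[ℝ] E (P.n i) →L[ℝ] Z) p := by
    intro Z _ _ φ hφ h1 h2
    have := HasFDerivAt.comp (g := fun z : E (P.n j) × E (P.n i) => dY φ z.1 z.2) p
      (hasFDerivAt_dY_zero hφ h1 h2) hz
    rwa [ContinuousLinearMap.zero_comp] at this
  have hl : DifferentiableAt ℝ (fun p : P.Var => (p j).2.1) p :=
    (HasFDerivAt.fst (HasFDerivAt.snd (hasFDerivAt_apply (𝕜 := ℝ) j p))).differentiableAt
  have hm : DifferentiableAt ℝ (fun p : P.Var => (p j).2.2) p :=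
    (HasFDerivAt.snd (HasFDerivAt.snd (hasFDerivAt_apply (𝕜 := ℝ) j p))).differentiableAt
  have h1 := hd (P.fCpl_smooth j i hij) (hc.f_xy j i hij) (hc.f_yy j i hij)
  have h2 := hasFDerivAt_pairing_comp hl
    (hd (P.gCpl_smooth j i hij) (hc.g_xy j i hij) (hc.g_yy j i hij)) (.inl (hc.g_y j i hij))
  have h3 := hasFDerivAt_pairing_comp hm
    (hd (P.hCpl_smooth j i hij) (hc.h_xy j i hij) (hc.h_yy j i hij)) (.inl (hc.h_y j i hij))
  have h4 := (riesz (E (P.n i))).hasFDerivAt.comp p ((h1.add h2).add h3)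
  rwa [add_zero, add_zero, ContinuousLinearMap.comp_zero] at h4

/-- The Jacobian of `Fhat` in the previous iterate vanishes. -/
theorem hasFDerivAt_Fhat_prev {p : P.Var} (hc : P.CouplingVanishes (P.xOf p)) :
    HasFDerivAt (fun prev => P.Fhat p prev) (0 : P.Var →L[ℝ] P.Var) p := by
  refine hasFDerivAt_pi'' fun i => ?_
  rw [ContinuousLinearMap.comp_zero]
  have hgrad : HasFDerivAt (fun prev : P.Var => gradient
      (fun y => P.lag i y (p i).2.1 (p i).2.2 (P.xOf prev)) (p i).1)
      (0 : P.Var →L[ℝ] E (P.n i)) p := by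
    have h0 : (fun prev : P.Var => gradient
        (fun y => P.lag i y (p i).2.1 (p i).2.2 (P.xOf prev)) (p i).1) = _ :=
      funext fun prev => congrArg (riesz _) (fderiv_lagr
        ((P.contDiff_f (i := i) contDiff_id (contDiff_const (c := P.xOf prev))).differentiable
          (by norm_num))
        ((P.contDiff_g (i := i) contDiff_id (contDiff_const (c := P.xOf prev))).differentiable
          (by norm_num))
        ((P.contDiff_h (i := i) contDiff_id (contDiff_const (c := P.xOf prev))).differentiable
          (by norm_num)) (p i).2.1 (p i).2.2 (p i).1)
    rw [h0]
    have h1 := hasFDerivAt_fderiv_coupled (P.fLoc_smooth i) (P.fCpl_smooth i) (p := p)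
      (hc.f_xy i)
    have h2 := hasFDerivAt_pairing_comp (differentiableAt_const (p i).2.1)
      (hasFDerivAt_fderiv_coupled (P.gLoc_smooth i) (P.gCpl_smooth i) (p := p) (hc.g_xy i))
      (.inr (by simp))
    have h3 := hasFDerivAt_pairing_comp (differentiableAt_const (p i).2.2)
      (hasFDerivAt_fderiv_coupled (P.hLoc_smooth i) (P.hCpl_smooth i) (p := p) (hc.h_xy i))
      (.inr (by simp))
    have h4 := (riesz (E (P.n i))).hasFDerivAt.comp p ((h1.add h2).add h3)
    rwa [add_zero, add_zero, ContinuousLinearMap.comp_zero] at h4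
  have hsens : HasFDerivAt (fun prev => ∑ j ∈ P.nbrs i, P.sens prev i j)
      (0 : P.Var →L[ℝ] E (P.n i)) p := by
    simpa using HasFDerivAt.fun_sum (u := P.nbrs i)
      fun j hj => hasFDerivAt_sens hc (P.mem_nbrs.mp hj).symm
  have hg : HasFDerivAt (fun prev : P.Var => P.g i (p i).1 (P.xOf prev))
      (0 : P.Var →L[ℝ] E (P.ng i)) p :=
    hasFDerivAt_coupled (P.gCpl_smooth i) (hc.g_y i)
  have hh : HasFDerivAt (fun prev : P.Var => P.h i (p i).1 (P.xOf prev))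
      (0 : P.Var →L[ℝ] E (P.nh i)) p :=
    hasFDerivAt_coupled (P.hCpl_smooth i) (hc.h_y i)
  have hcompl : HasFDerivAt (fun prev : P.Var => (WithLp.toLp 2
      (fun k => (p i).2.2 k * P.h i (p i).1 (P.xOf prev) k) : E (P.nh i)))
      (0 : P.Var →L[ℝ] E (P.nh i)) p := by
    rw [← hasFDerivWithinAt_univ, hasFDerivWithinAt_euclidean]
    intro k
    rw [hasFDerivWithinAt_univ, ContinuousLinearMap.comp_zero]
    have h1 := ((EuclideanSpace.proj k : E (P.nh i) →L[ℝ] ℝ).hasFDerivAt.comp p hh).const_mul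
      ((p i).2.2 k)
    rwa [ContinuousLinearMap.comp_zero, smul_zero] at h1
  have := (hgrad.add hsens).prodMk (hg.prodMk hcompl)
  refine this.congr_fderiv ?_
  ext <;> simp

end Vanishing

end NeighborAffineNLP

namespace NeighborAffineNLP

variable {M : ℕ} {P : NeighborAffineNLP M}

/-! ### Comparison of the Euclidean norm with the product norm. -/

section Norm

theorem norm_le_eNorm (p : P.Var) : ‖p‖ ≤ P.eNorm p := by
  have key : ∀ i, ‖(p i).1‖ ^ 2 + ‖(p i).2.1‖ ^ 2 + ‖(p i).2.2‖ ^ 2 ≤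
      ∑ i, (‖(p i).1‖ ^ 2 + ‖(p i).2.1‖ ^ 2 + ‖(p i).2.2‖ ^ 2) := fun i =>
    Finset.single_le_sum (f := fun i => ‖(p i).1‖ ^ 2 + ‖(p i).2.1‖ ^ 2 + ‖(p i).2.2‖ ^ 2)
      (fun _ _ => by positivity) (Finset.mem_univ i)
  refine (pi_norm_le_iff_of_nonneg (Real.sqrt_nonneg _)).mpr fun i => ?_
  have h1 := sq_nonneg ‖(p i).1‖
  have h2 := sq_nonneg ‖(p i).2.1‖
  have h3 := sq_nonneg ‖(p i).2.2‖
  have h4 := key i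
  exact max_le (Real.le_sqrt_of_sq_le (by linarith))
    (max_le (Real.le_sqrt_of_sq_le (by linarith)) (Real.le_sqrt_of_sq_le (by linarith)))

/-- There are $3M$ blocks, each of norm at most $\|p\|$, and $3M\le(3M+1)^2$; the added $1$ keeps
the constant positive when $M=0$. -/
theorem eNorm_le (p : P.Var) : P.eNorm p ≤ (3 * M + 1) * ‖p‖ := by
  refine Real.sqrt_le_iff.mpr ⟨by positivity, ?_⟩
  have key : ∀ i, ‖(p i).1‖ ^ 2 + ‖(p i).2.1‖ ^ 2 + ‖(p i).2.2‖ ^ 2 ≤ 3 * ‖p‖ ^ 2 := by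
    intro i
    have h0 := norm_le_pi_norm p i
    have h1 : ‖(p i).1‖ ≤ ‖p‖ := (norm_fst_le _).trans h0
    have h2 : ‖(p i).2.1‖ ≤ ‖p‖ := ((norm_fst_le _).trans (norm_snd_le _)).trans h0
    have h3 : ‖(p i).2.2‖ ≤ ‖p‖ := ((norm_snd_le _).trans (norm_snd_le _)).trans h0
    have := pow_le_pow_left₀ (norm_nonneg _) h1 2
    have := pow_le_pow_left₀ (norm_nonneg _) h2 2
    have := pow_le_pow_left₀ (norm_nonneg _) h3 2
    linarith
  have h1 := Finset.sum_le_sum fun i (_ : i ∈ Finset.univ) => key i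
  rw [Finset.sum_const, Finset.card_univ, Fintype.card_fin, nsmul_eq_mul] at h1
  have hM : (0 : ℝ) ≤ M := M.cast_nonneg
  have hp : 0 ≤ ‖p‖ ^ 2 := by positivity
  nlinarith [mul_nonneg hM hp, mul_nonneg (mul_nonneg hM hM) hp]

theorem exists_nhd_subset {p₀ : P.Var} {S : Set P.Var} (hS : S ∈ 𝓝 p₀) :
    ∃ r : ℝ, 0 < r ∧ P.nhd p₀ r ⊆ S := by
  obtain ⟨ε, hε, hsub⟩ := Metric.mem_nhds_iff.mp hS
  refine ⟨ε / 2, by positivity, fun p hp => hsub ?_⟩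
  rw [Metric.mem_ball, dist_eq_norm]
  exact ((norm_le_eNorm _).trans hp).trans_lt (by linarith)

theorem nhd_mem_nhds (p₀ : P.Var) {r : ℝ} (hr : 0 < r) : P.nhd p₀ r ∈ 𝓝 p₀ := by
  have hK : (0 : ℝ) < 3 * M + 1 := by positivity
  refine Metric.mem_nhds_iff.mpr ⟨r / (3 * M + 1), by positivity, fun p hp => ?_⟩
  rw [Metric.mem_ball, dist_eq_norm, lt_div_iff₀ hK] at hp
  exact (eNorm_le _).trans (by linarith)

end Norm

/-! ### Local programs near a regular central KKT point. -/

section KKT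

theorem lag_congr {j : Fin M} {y : E (P.n j)} {l : E (P.ng j)} {m : E (P.nh j)} {x x' : P.XVar}
    (h : ∀ k ∈ P.nbrs j, x k = x' k) : P.lag j y l m x = P.lag j y l m x' := by
  have hs : ∀ {Z : Type} [AddCommMonoid Z] (φ : ∀ k, E (P.n k) → Z),
      ∑ k ∈ P.nbrs j, φ k (x k) = ∑ k ∈ P.nbrs j, φ k (x' k) := fun φ =>
    Finset.sum_congr rfl fun k hk => by rw [h k hk]
  simp only [lag, f, g, NeighborAffineNLP.h, hs fun k => P.fCpl j k y, hs fun k => P.gCpl j k y,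
    hs fun k => P.hCpl j k y]

/-- A central KKT point solves the KKT equalities of the local programs built from it. -/
theorem Fhat_self {p : P.Var} (hp : P.IsCentralKKT p) : P.Fhat p p = 0 := by
  funext i
  have hcompl : (WithLp.toLp 2 (fun k => (p i).2.2 k * P.h i (p i).1 (P.xOf p) k) :
      E (P.nh i)) = 0 := by
    ext k
    exact hp.compl i k
  refine Prod.ext ?_ (Prod.ext (hp.eq_zero i) hcompl)
  have hself : i ∉ P.nbrs i := fun h => P.graph.loopless.irrefl i (P.mem_nbrs.mp h)
  -- As a function of $x_i$, the central Lagrangian consists of the agent's own term, the neighbors'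
  -- terms, and a constant; symmetry of the graph rules out any other dependence.
  have hsplit : (fun y => P.centralLag p (Function.update (P.xOf p) i y)) = fun y =>
      (P.lag i y (p i).2.1 (p i).2.2 (P.xOf p) + ∑ j ∈ P.nbrs i, P.lag j (p j).1 (p j).2.1
        (p j).2.2 (Function.update (P.xOf p) i y)) + ∑ j ∈ Finset.univ.erase i \ P.nbrs i,
          P.lag j (p j).1 (p j).2.1 (p j).2.2 (P.xOf p) := by
    ext1 y
    rw [centralLag, ← Finset.add_sum_erase _ _ (Finset.mem_univ i), add_assoc]
    congr 1
    · rw [Function.update_self]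
      exact lag_congr fun k hk => Function.update_of_ne (ne_of_mem_of_not_mem hk hself) _ _
    · have hsub : P.nbrs i ⊆ Finset.univ.erase i := fun j hj =>
        Finset.mem_erase.mpr ⟨fun h => hself (h ▸ hj), Finset.mem_univ j⟩
      rw [← Finset.sum_sdiff hsub, add_comm]
      congr 1
      · refine Finset.sum_congr rfl fun j hj => ?_
        rw [Function.update_of_ne (ne_of_mem_of_not_mem hj hself)]
        rfl
      · refine Finset.sum_congr rfl fun j hj => ?_
        obtain ⟨hj1, hj2⟩ := Finset.mem_sdiff.mp hj
        rw [Function.update_of_ne (Finset.ne_of_mem_erase hj1)]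
        exact lag_congr fun k hk => Function.update_of_ne
          (fun h => hj2 (P.mem_nbrs.mpr (P.mem_nbrs.mp (h ▸ hk)).symm)) _ _
  have hu : ContDiff ℝ 3 fun y : E (P.n i) => Function.update (P.xOf p) i y :=
    P.contDiff_update contDiff_const contDiff_id
  have h1 : HasFDerivAt (fun y => P.lag i y (p i).2.1 (p i).2.2 (P.xOf p)) _ (p i).1 :=
    ((P.contDiff_lag (i := i) contDiff_id contDiff_const contDiff_const
      contDiff_const).differentiable (by norm_num) _).hasFDerivAt
  have h2 : ∀ j, HasFDerivAt (fun y => P.lag j (p j).1 (p j).2.1 (p j).2.2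
      (Function.update (P.xOf p) i y)) _ (p i).1 := fun j =>
    ((P.contDiff_lag (i := j) contDiff_const contDiff_const contDiff_const
      hu).differentiable (by norm_num) _).hasFDerivAt
  have h3 := ((h1.add (HasFDerivAt.fun_sum (u := P.nbrs i) fun j _ => h2 j)).add_const
    (∑ j ∈ Finset.univ.erase i \ P.nbrs i, P.lag j (p j).1 (p j).2.1 (p j).2.2 (P.xOf p))).fderiv
  have h4 := hp.stationary i
  rw [hsplit, riesz_fderiv] at h4
  have h5 := (congrArg (riesz _) h3).symm.trans h4
  rw [map_add, map_sum] at h5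
  exact h5

variable {p : P.Var}

/-- The Jacobian of `Fhat` in its first argument is injective at a regular point. -/
theorem fderiv_Fhat_injective (hc : P.CentralRegular p) (hl : P.LocalRegular p) (v : P.Var)
    (hv : fderiv ℝ (fun q => P.Fhat q p) p v = 0) : v = 0 := by
  have hf := fun i => (P.contDiff_f (i := i) contDiff_id (contDiff_const (c := P.xOf p))).of_le
    (m := 2) (by norm_num)
  have hg := fun i => (P.contDiff_g (i := i) contDiff_id (contDiff_const (c := P.xOf p))).of_le
    (m := 2) (by norm_num)
  have hh := fun i => (P.contDiff_h (i := i) contDiff_id (contDiff_const (c := P.xOf p))).of_le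
    (m := 2) (by norm_num)
  -- With the previous iterate frozen, the sensitivities are a constant linear term and block $i$ of
  -- `Fhat` depends on $p_i$ alone.
  have key := fun i => kktMap_fderiv_injective (hf i) (hg i) (hh i)
    (∑ j ∈ P.nbrs i, P.sens p i j) (q := p i) (hc.kkt.compl i) (hc.strict i) (hl.sosc i)
    (hl.licq i)
  have hd : HasFDerivAt (fun q => P.Fhat q p) _ p := hasFDerivAt_pi.mpr fun i =>
    HasFDerivAt.comp (f := fun q : P.Var => q i) p (key i).1.hasFDerivAt (hasFDerivAt_apply i p)
  rw [hd.fderiv] at hv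
  funext i
  exact (key i).2 (v i) (congrFun hv i)

open Classical in
/-- Near a regular point, solutions of the KKT equalities are results of the algorithm. -/
theorem eventually_isStep (hc : P.CentralRegular p) (hl : P.LocalRegular p) :
    ∀ᶠ v : P.Var × P.Var in 𝓝 (p, p), P.Fhat v.2 v.1 = 0 → P.IsStep v.1 v.2 := by
  set s : ∀ i, Finset (Fin (P.nh i)) := fun i => Finset.univ.filter (P.Active p i) with hs
  have hf := fun (x : P.XVar) i => (P.contDiff_f (i := i) contDiff_id
    (contDiff_const (c := x))).of_le (m := 2) (by norm_num)
  have hg := fun (x : P.XVar) i => (P.contDiff_g (i := i) contDiff_id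
    (contDiff_const (c := x))).of_le (m := 2) (by norm_num)
  have hh := fun (x : P.XVar) i => (P.contDiff_h (i := i) contDiff_id
    (contDiff_const (c := x))).of_le (m := 2) (by norm_num)
  have hx : ContDiff ℝ 3 fun v : P.Var × P.Var => P.xOf v.1 := P.contDiff_xOf contDiff_fst
  have hq : ∀ i, ContDiff ℝ 3 fun v : P.Var × P.Var => v.2 i := fun i =>
    contDiff_pi.mp contDiff_snd i
  have haug := fun i => exists_augmented_pos (s := s i)
    (contDiff_lagr (hf (P.xOf p) i) (hg (P.xOf p) i) (hh (P.xOf p) i) (p i).2.1 (p i).2.2)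
    (hg (P.xOf p) i) (hh (P.xOf p) i) (x := (p i).1) (hc.kkt.eq_zero i)
    (fun k hk => (Finset.mem_filter.mp hk).2)
    (fun v hv hv1 hv2 => hl.sosc i v hv hv1 fun k hk =>
      hv2 k (Finset.mem_filter.mpr ⟨Finset.mem_univ k, hk⟩))
  -- The penalty weights are fixed at the base point; openness of positive definiteness then lets
  -- the same weights serve all nearby pairs of iterates.
  choose c hcpos using haug
  have ev1 : ∀ i, ∀ᶠ v : P.Var × P.Var in 𝓝 (p, p), ∀ t, t ≠ 0 → 0 < hess (fun y =>
      lagr (fun y => P.f i y (P.xOf v.1)) (fun y => P.g i y (P.xOf v.1))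
        (fun y => P.h i y (P.xOf v.1)) (v.2 i).2.1 (v.2 i).2.2 y + c i *
        penalty (fun y => P.g i y (P.xOf v.1)) (fun y => P.h i y (P.xOf v.1)) (s i) y)
      (v.2 i).1 t t := by
    intro i
    refine eventually_pos_def (Continuous.continuousAt (continuous_hess ?_ (hq i).fst)) (hcpos i)
    have hx' : ContDiff ℝ 3 fun z : (P.Var × P.Var) × E (P.n i) => P.xOf z.1.1 :=
      hx.comp contDiff_fst
    have hq' : ContDiff ℝ 3 fun z : (P.Var × P.Var) × E (P.n i) => z.1.2 i :=
      (hq i).comp contDiff_fst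
    refine (P.contDiff_lag contDiff_snd hq'.snd.fst hq'.snd.snd hx').add
      (contDiff_const.mul (ContDiff.add (ContDiff.sum fun k _ => ?_) (ContDiff.sum fun k _ => ?_)))
    · exact (contDiff_apply (P.contDiff_g contDiff_snd hx') k).pow 2
    · exact (contDiff_apply (P.contDiff_h contDiff_snd hx') k).pow 2
  have ev2 : ∀ i k, P.Active p i k → ∀ᶠ v : P.Var × P.Var in 𝓝 (p, p), 0 < (v.2 i).2.2 k :=
    fun i k hk => (contDiff_apply (hq i).snd.snd k).continuous.continuousAt.eventually
      (lt_mem_nhds (hc.strict i k hk))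
  have ev3 : ∀ i k, ¬ P.Active p i k →
      ∀ᶠ v : P.Var × P.Var in 𝓝 (p, p), P.h i (v.2 i).1 (P.xOf v.1) k < 0 :=
    fun i k hk => (contDiff_apply (P.contDiff_h (hq i).fst hx) k).continuous.continuousAt.eventually
      (gt_mem_nhds ((hc.kkt.nonpos i k).lt_of_ne hk))
  have ev23 : ∀ᶠ v : P.Var × P.Var in 𝓝 (p, p), ∀ i k,
      (P.Active p i k → 0 < (v.2 i).2.2 k) ∧
        (¬ P.Active p i k → P.h i (v.2 i).1 (P.xOf v.1) k < 0) := by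
    refine eventually_all.mpr fun i => eventually_all.mpr fun k => ?_
    by_cases hk : P.Active p i k
    · filter_upwards [ev2 i k hk] with v hv using ⟨fun _ => hv, fun h => absurd hk h⟩
    · filter_upwards [ev3 i k hk] with v hv using ⟨fun h => absurd h hk, fun _ => hv⟩
  filter_upwards [eventually_all.mpr ev1, ev23] with v hv1 hv23 hF
  have hcompl : ∀ i k, (v.2 i).2.2 k * P.h i (v.2 i).1 (P.xOf v.1) k = 0 := fun i k =>
    congrArg (fun w : P.Var => (w i).2.2 k) hF
  -- Positive multipliers and negative constraint values persist nearby, so the complementarity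
  -- equations decide the other factor and the active set stays that of $p$.
  have hact : ∀ i k, P.Active p i k → P.h i (v.2 i).1 (P.xOf v.1) k = 0 := fun i k hk =>
    (mul_eq_zero.mp (hcompl i k)).resolve_left ((hv23 i k).1 hk).ne'
  have hinact : ∀ i k, ¬ P.Active p i k → (v.2 i).2.2 k = 0 := fun i k hk =>
    (mul_eq_zero.mp (hcompl i k)).resolve_right ((hv23 i k).2 hk).ne
  refine ⟨⟨hF, fun i k => ?_, fun i k => ?_⟩, fun i => ?_⟩
  · by_cases hk : P.Active p i k
    · exact (hact i k hk).le
    · exact ((hv23 i k).2 hk).le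
  · by_cases hk : P.Active p i k
    · exact ((hv23 i k).1 hk).le
    · exact (hinact i k hk).ge
  · have hobj : P.localObj v.1 i = fun y => P.f i y (P.xOf v.1) +
        innerSL ℝ (∑ j ∈ P.nbrs i, P.sens v.1 i j) (y - (v.1 i).1) := by
      ext1 y
      rw [localObj, innerSL_apply_apply, sum_inner]
    rw [hobj]
    refine isLocalMinOn_of_augmented (hf _ i) (hg _ i) (hh _ i) _ _ (s := s i)
      (lam := (v.2 i).2.1) (mu := (v.2 i).2.2) (congrArg (fun w : P.Var => (w i).2.1) hF)
      (fun k hk => ?_) (fun k hk => ?_) ?_ (hv1 i)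
    · have hk' := (Finset.mem_filter.mp hk).2
      exact ⟨hact i k hk', (hv23 i k).1 hk'⟩
    · exact hinact i k fun hk' => hk (Finset.mem_filter.mpr ⟨Finset.mem_univ k, hk'⟩)
    · ext t
      have h1 : riesz _ (fderiv ℝ (fun y => P.lag i y (v.2 i).2.1 (v.2 i).2.2 (P.xOf v.1))
          (v.2 i).1) + ∑ j ∈ P.nbrs i, P.sens v.1 i j = 0 :=
        congrArg (fun w : P.Var => (w i).1) hF
      have h2 := congrArg (fun w => inner ℝ w t) h1
      simp only [inner_add_left, inner_riesz, inner_zero_left] at h2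
      exact h2

end KKT

end NeighborAffineNLP

end SBDP

/-! ### Choice of radii and convergence of the iteration. -/

theorem mainTheorem2 {M : ℕ} (P : SBDP.NeighborAffineNLP M) (pstar : P.Var)
    (hcentral : P.CentralRegular pstar) (hlocal : P.LocalRegular pstar)
    (hcpl : P.CouplingVanishes (P.xOf pstar)) :
    ∃ (ρ r₁ : ℝ) (Φ : P.Var → P.Var), 0 < ρ ∧ 0 < r₁ ∧
      -- near `pstar`, the local programs have a unique solution `Φ p` close to `pstar`
      (∀ p ∈ P.nhd pstar r₁,
        ContDiffAt ℝ 1 Φ p ∧ Φ p ∈ P.nhd pstar ρ ∧ P.IsStep p (Φ p) ∧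
        ∀ p' ∈ P.nhd pstar ρ, P.IsLocalKKT p p' → p' = Φ p) ∧
      Φ pstar = pstar ∧
      -- `N(pstar) = 0`
      HasFDerivAt (fun p => P.Fhat (Φ pstar) p) (0 : P.Var →L[ℝ] P.Var) pstar ∧
      -- `J(pstar) = 0`
      HasFDerivAt Φ (0 : P.Var →L[ℝ] P.Var) pstar ∧
      -- local quadratic convergence of the algorithm
      ∃ (r C : ℝ), 0 < r ∧ r ≤ r₁ ∧ ∀ p0 ∈ P.nhd pstar r,
        (∃! p : ℕ → P.Var, P.IsRun (P.nhd pstar ρ) p0 p) ∧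
        ∀ p : ℕ → P.Var, P.IsRun (P.nhd pstar ρ) p0 p →
          (∀ q, p q ∈ P.nhd pstar r) ∧
          (∀ q, p (q + 1) = Φ (p q)) ∧
          Tendsto p atTop (𝓝 pstar) ∧
          ∀ q, P.eNorm (p (q + 1) - pstar) ≤ C * P.eNorm (p q - pstar) ^ 2 := by
  have hN := SBDP.NeighborAffineNLP.hasFDerivAt_Fhat_prev hcpl
  obtain ⟨Φ, hΦ, hΦ0, hJ, hiff⟩ := SBDP.exists_implicit_map (F := P.Fhat)
    (P.contDiff_Fhat contDiff_snd contDiff_fst) (SBDP.NeighborAffineNLP.Fhat_self hcentral.kkt)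
    (SBDP.NeighborAffineNLP.fderiv_Fhat_injective hcentral hlocal) hN
  obtain ⟨C, hC, hquad⟩ := SBDP.exists_quadratic_bound hΦ hJ
  -- $S$ bounds the previous iterate and $T$ the new one. The radius $\rho$ is chosen inside $T$
  -- first, and then $r_1$ so small that $\Phi$ maps into the $\rho$-ball.
  obtain ⟨S, hS, T, hT, hST⟩ := mem_nhds_prod_iff.mp
    (hiff.and (SBDP.NeighborAffineNLP.eventually_isStep hcentral hlocal))
  obtain ⟨ρ, hρ, hρT⟩ := SBDP.NeighborAffineNLP.exists_nhd_subset hT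
  have hcont : ∀ᶠ p in 𝓝 pstar, Φ p ∈ P.nhd pstar ρ :=
    hΦ.continuousAt.eventually (by rw [hΦ0]; exact SBDP.NeighborAffineNLP.nhd_mem_nhds pstar hρ)
  obtain ⟨r₁, hr₁, hsub⟩ := SBDP.NeighborAffineNLP.exists_nhd_subset
    (Filter.inter_mem hS (((hΦ.eventually (by simp)).and hcont).and hquad))
  have hstep : ∀ p ∈ P.nhd pstar r₁, ContDiffAt ℝ 1 Φ p ∧ Φ p ∈ P.nhd pstar ρ ∧
      P.IsStep p (Φ p) ∧ ∀ p' ∈ P.nhd pstar ρ, P.IsLocalKKT p p' → p' = Φ p := by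
    intro p hp
    obtain ⟨hpS, ⟨hp1, hp2⟩, -⟩ := hsub hp
    have h1 := @hST (p, Φ p) ⟨hpS, hρT hp2⟩
    refine ⟨hp1.of_le (by norm_num), hp2, h1.2 (h1.1.mpr rfl), fun p' hp' hkkt => ?_⟩
    have h2 := @hST (p, p') ⟨hpS, hρT hp'⟩
    exact (h2.1.mp hkkt.eqs).symm
  -- The factor $3M+1$ is the price of passing from the product norm back to the Euclidean one.
  set K : ℝ := (3 * M + 1) * C
  have hK : 0 < K := by positivity
  have hest : ∀ p ∈ P.nhd pstar r₁, P.eNorm (Φ p - pstar) ≤ K * P.eNorm (p - pstar) ^ 2 := by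
    intro p hp
    have h1 : ‖Φ p - Φ pstar‖ ≤ C * ‖p - pstar‖ ^ 2 := (hsub hp).2.2
    rw [hΦ0] at h1
    have h2 := pow_le_pow_left₀ (norm_nonneg _)
      (SBDP.NeighborAffineNLP.norm_le_eNorm (p - pstar)) 2
    calc P.eNorm (Φ p - pstar) ≤ (3 * M + 1) * ‖Φ p - pstar‖ := SBDP.NeighborAffineNLP.eNorm_le _
      _ ≤ (3 * M + 1) * (C * P.eNorm (p - pstar) ^ 2) := by
        gcongr
        exact h1.trans (by gcongr)
      _ = K * P.eNorm (p - pstar) ^ 2 := by ring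
  -- For $\|p-p^*\|\le 1/(2K)$ the quadratic bound at least halves the error; this makes the ball
  -- invariant and the iteration convergent.
  set r : ℝ := min r₁ (1 / (2 * K))
  have hr : 0 < r := lt_min hr₁ (by positivity)
  have hrr : P.nhd pstar r ⊆ P.nhd pstar r₁ := by
    intro p (hp : P.eNorm (p - pstar) ≤ r)
    exact hp.trans (min_le_left _ _)
  have hhalf : ∀ p ∈ P.nhd pstar r, P.eNorm (Φ p - pstar) ≤ 1 / 2 * P.eNorm (p - pstar) := by
    intro p hp
    have h0 : 0 ≤ P.eNorm (p - pstar) := Real.sqrt_nonneg _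
    have h1 : K * P.eNorm (p - pstar) ≤ 1 / 2 := by
      calc K * P.eNorm (p - pstar) ≤ K * (1 / (2 * K)) := by
            gcongr
            exact le_trans hp (min_le_right _ _)
        _ = 1 / 2 := by field_simp
    calc P.eNorm (Φ p - pstar) ≤ K * P.eNorm (p - pstar) ^ 2 := hest p (hrr hp)
      _ = (K * P.eNorm (p - pstar)) * P.eNorm (p - pstar) := by ring
      _ ≤ _ := by gcongr
  have hmap : ∀ p ∈ P.nhd pstar r, Φ p ∈ P.nhd pstar r := fun p hp => by
    have h0 : 0 ≤ P.eNorm (p - pstar) := Real.sqrt_nonneg _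
    have h1 := hhalf p hp
    have h2 : P.eNorm (p - pstar) ≤ r := hp
    exact h1.trans (by linarith)
  refine ⟨ρ, r₁, Φ, hρ, hr₁, hstep, hΦ0, by rwa [hΦ0], hJ, r, K, hr, min_le_left _ _,
    fun p0 hp0 => ?_⟩
  have hrun : ∀ p : ℕ → P.Var, P.IsRun (P.nhd pstar ρ) p0 p →
      (∀ q, p q ∈ P.nhd pstar r) ∧ ∀ q, p (q + 1) = Φ (p q) := by
    intro p hp
    -- Uniqueness of the local solution is available only for iterates already in the small ball, so
    -- membership is propagated by induction along with the identity.
    have hnext : ∀ q, p q ∈ P.nhd pstar r → p (q + 1) = Φ (p q) := fun q hq =>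
      (hstep _ (hrr hq)).2.2.2 _ (hp.mem q) (hp.step q).kkt
    have hall : ∀ q, p q ∈ P.nhd pstar r := by
      intro q
      induction q with
      | zero => rw [hp.init]; exact hp0
      | succ q ih => rw [hnext q ih]; exact hmap _ ih
    exact ⟨hall, fun q => hnext q (hall q)⟩
  have hiter : ∀ q, Φ^[q] p0 ∈ P.nhd pstar r := by
    intro q
    induction q with
    | zero => exact hp0
    | succ q ih => rw [Function.iterate_succ_apply']; exact hmap _ ih
  refine ⟨⟨fun q => Φ^[q] p0, ⟨rfl, fun q => ?_, fun q => ?_⟩, fun p hp => ?_⟩, fun p hp => ?_⟩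
  · rw [Function.iterate_succ_apply']
    exact (hstep _ (hrr (hiter q))).2.2.1
  · rw [Function.iterate_succ_apply']
    exact (hstep _ (hrr (hiter q))).2.1
  · funext q
    induction q with
    | zero => exact hp.init
    | succ q ih => rw [(hrun p hp).2 q, ih, Function.iterate_succ_apply']
  · obtain ⟨hall, hnext⟩ := hrun p hp
    refine ⟨hall, hnext, ?_, fun q => by rw [hnext q]; exact hest _ (hrr (hall q))⟩
    have hgeo : ∀ q, P.eNorm (p q - pstar) ≤ (1 / 2) ^ q * r := by
      intro q
      induction q with
      | zero =>
        rw [pow_zero, one_mul]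
        exact hall 0
      | succ q ih =>
        rw [hnext q]
        have := hhalf _ (hall q)
        rw [pow_succ]
        linarith
    refine tendsto_iff_norm_sub_tendsto_zero.mpr (squeeze_zero (fun _ => norm_nonneg _)
      (fun q => (SBDP.NeighborAffineNLP.norm_le_eNorm _).trans (hgeo q)) ?_)
    simpa using (tendsto_pow_atTop_nhds_zero_of_lt_one (r := (1 / 2 : ℝ)) (by norm_num)
      (by norm_num)).mul_const r
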